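/- **Theorem (amenable graphs).** All graphs are finite, simple and undirected, with vertex colours (labels) from an arbitrary set; uncoloured graphs are the case of a constant colouring, and isomorphisms preserve colours. *Colour refinement* starts with the given colours $\lambda_0$ and sets $\lambda_{i+1}(v)=(\lambda_i(v),\{\!\{\lambda_i(u) : u \text{ adjacent to } v\}\!\})$, the same for all graphs. A graph $G$ is *amenable to colour refinement* if for every graph $G'$: $G'$ is isomorphic to $G$ if and only if $\{\!\{\lambda_i(v): v\in V(G)\}\!\}=\{\!\{\lambda_i(v): v\in V(G')\}\!\}$ for all $i\ge 0$. *Weisfeiler–Lehman tree.* For $h\ge 0$ the tree $T$ of $G$ and $H$ has a root, a further node $x$ below the root, and as nodes the pairs $(i,c)$, $0\le i\le h$, where $c$ is a colour that occurs in $G$ or $H$ after $i$ rounds; $(0,c)$ is a child of the root and $(i+1,c)$ is a child of $(i,c')$, where $c'$ is the colour refined by $c$. Let $A$ consist of $V(G)$ and $|V(H)|$ artificial elements, and $B$ of $V(H)$ and $|V(G)|$ artificial elements. A vertex is placed at the node $(h,\lambda_h(v))$, an artificial element at $x$. *Modified assignment algorithm.* Start with the empty assignment $M$. As long as more than one node of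 $T$ remains, select a node $k$ with exactly one remaining neighbour $n$, pair the elements of $A$ and of $B$ currently at $k$ one-to-one until one of the two sides is exhausted, add these pairs to $M$, pass the unmatched elements to $n$, and remove $k$; at the last node only pair the elements and remove the node. Choices are arbitrary up to two rules. (i) The pairs chosen at $k$ must respect edges, if this is possible: whenever $(a,b)$ is a new pair and $(a',b')$ is a new or an earlier pair, $a,a'\in V(G)$ and $b,b'\in V(H)$, then $aa'\in E(G)\Leftrightarrow bb'\in E(H)$. If no such choice exists, the pairing is arbitrary. (ii) The order in which the nodes $(h,c)$ are selected is restricted as follows. Call $X_c=\{v\in V(G):\lambda_h(v)=c\}$ a cell, call it heterogeneous if $G[X_c]$ is neither empty nor complete, and join two distinct cells by an anisotropic edge if the bipartite graph of the edges of $G$ between them is neither empty nor complete. The node $(h,c)$ may be selected if $X_c$ has an anisotropic edge to an already processed cell, or if no cell of its connected component with respect to anisotropic edges has been processed, $X_c$ has minimum size in this component, and $X_c$ is heterogeneous whenever some cell of minimum size in the component is. *Approximate edit distance.* The assignment $M$ induces an edit path from $G$ to $H$: vertices paired with vertices are substituted, vertices of $G$ (of $H$) paired with artificial elements are deleted (inserted),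 edges of $G$ (of $H$) not mapped by $M$ to (from) an edge of the other graph are deleted (inserted), and the other edges are substituted. Costs are non-zero: deleting or inserting a vertex (depending on its colour) or an edge and substituting a vertex by one of a different colour have arbitrary fixed positive costs, while substituting a vertex by one of the same colour, or an edge by an edge, costs $0$. $\widehat{\mathit{GED}}(G,H)$ is the total cost of this edit path. *Claim.* Let $G$ and $H$ be amenable to colour refinement, and let $h$ be such that for each of the two graphs $\lambda_h$ and $\lambda_{h+1}$ induce the same partition of the vertex set. Then the algorithm has a complete run, and for every complete run, whatever choices are made, $$\widehat{\mathit{GED}}(G,H)=0 \iff G \text{ and } H \text{ are isomorphic}.$$ -/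

import Mathlib

/-! Colour refinement -/

/-- The colours available after `i` rounds of colour refinement. A refined colour is the pair of the
previous colour of a vertex and the multiset of the previous colours of its neighbours, so the
injective colour map is the same for all graphs. -/
def WLColour (L : Type*) : ℕ → Type _
  | 0 => L
  | i + 1 => WLColour L i × Multiset (WLColour L i)

open Classical in
/-- The colouring of the vertices of `G` after `i` rounds, starting from the initial colours `l`. -/
noncomputable def wlColour {V L : Type*} [Fintype V] (G : SimpleGraph V) (l : V → L) :
    (i : ℕ) → V → WLColour L i
  | 0 => l
  | i + 1 => fun v =>
      (wlColour G l i v, (Finset.univ.filter fun u => G.Adj v u).val.map (wlColour G l i))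

/-- Colour refinement does not distinguish the two graphs: after every number of rounds the two
multisets of colours agree. -/
def WLEquivalent {V W L : Type*} [Fintype V] [Fintype W] (G : SimpleGraph V) (lG : V → L)
    (H : SimpleGraph W) (lH : W → L) : Prop :=
  ∀ i, (Finset.univ : Finset V).val.map (wlColour G lG i) =
    (Finset.univ : Finset W).val.map (wlColour H lH i)

/-- Isomorphism of graphs with initial colours. -/
def ColouredIso {V W L : Type*} (G : SimpleGraph V) (lG : V → L)
    (H : SimpleGraph W) (lH : W → L) : Prop :=
  ∃ f : G ≃g H, ∀ v, lH (f v) = lG v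

/-- `G` is amenable to colour refinement: a finite graph is isomorphic to `G` exactly if colour
refinement does not distinguish it from `G`. (Every finite graph has a copy on some `Fin n`.) -/
def Amenable {V L : Type*} [Fintype V] (G : SimpleGraph V) (l : V → L) : Prop :=
  ∀ (n : ℕ) (G' : SimpleGraph (Fin n)) (l' : Fin n → L),
    WLEquivalent G l G' l' ↔ ColouredIso G l G' l'

/-- The partitions of the vertex set after `h` and after `h + 1` rounds coincide. -/
def StableAt {V L : Type*} [Fintype V] (G : SimpleGraph V) (l : V → L) (h : ℕ) : Prop :=
  ∀ u v, wlColour G l h u = wlColour G l h v ↔ wlColour G l (h + 1) u = wlColour G l (h + 1) v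

/-! The Weisfeiler-Lehman tree of two graphs -/

/-- Possible tree nodes: the root, the node at which vertex deletions and insertions are accounted
for, and the colours of each round. -/
inductive WLNode (L : Type*) where
  | root : WLNode L
  | indel : WLNode L
  | colour (i : ℕ) (c : WLColour L i) : WLNode L

/-- The parent of a node (the root is its own parent, which gives no edge). -/
def WLNode.parent {L : Type*} : WLNode L → WLNode L
  | .root => .root
  | .indel => .root
  | .colour 0 _ => .root
  | .colour (i + 1) c => .colour i c.1

/-- Nodes are joined exactly if one is the parent of the other. -/
def wlTree (L : Type*) : SimpleGraph (WLNode L) :=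
  SimpleGraph.fromRel fun a b => a.parent = b

/-- The nodes of the tree of `G` and `H` with `h` rounds of refinement: the root, the node for
deletions and insertions, and all colours that occur in one of the rounds `0, …, h`. -/
def wlTreeNodes {V W L : Type*} [Fintype V] [Fintype W] (G : SimpleGraph V) (lG : V → L)
    (H : SimpleGraph W) (lH : W → L) (h : ℕ) : Set (WLNode L) :=
  {k | k = .root ∨ k = .indel ∨
    (∃ i ≤ h, ∃ v, k = .colour i (wlColour G lG i v)) ∨
    (∃ i ≤ h, ∃ w, k = .colour i (wlColour H lH i w))}

/-! The assignment instance. The objects on the side of `G` are the vertices of `G` and one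
artificial element for each vertex of `H` (used for insertions); on the side of `H` they are the
vertices of `H` and one artificial element for each vertex of `G` (used for deletions). -/

/-- The map from objects to tree nodes: a vertex goes to its colour after `h` rounds, an artificial
element to the node for deletions and insertions. -/
noncomputable def objectNode {V Z L : Type*} [Fintype V] (G : SimpleGraph V) (l : V → L) (h : ℕ) :
    V ⊕ Z → WLNode L
  | .inl v => .colour h (wlColour G l h v)
  | .inr _ => .indel

/-! The order in which colour classes are processed -/

/-- The colour class (cell) of the colour `c` in round `h`. -/
def cell {V L : Type*} [Fintype V] (G : SimpleGraph V) (l : V → L) (h : ℕ) (c : WLColour L h) :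
    Set V :=
  {v | wlColour G l h v = c}

/-- The graph induced by the cell is neither empty nor complete. -/
def Heterogeneous {V L : Type*} [Fintype V] (G : SimpleGraph V) (l : V → L) (h : ℕ)
    (c : WLColour L h) : Prop :=
  (∃ u ∈ cell G l h c, ∃ v ∈ cell G l h c, G.Adj u v) ∧
  (∃ u ∈ cell G l h c, ∃ v ∈ cell G l h c, u ≠ v ∧ ¬ G.Adj u v)

/-- The graph on the colours of round `h` whose edges are the anisotropic pairs: the bipartite graph
of the edges between the two cells is neither empty nor complete. -/
def anisoGraph {V L : Type*} [Fintype V] (G : SimpleGraph V) (l : V → L) (h : ℕ) :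
    SimpleGraph (WLColour L h) where
  Adj c d := c ≠ d ∧
    (∃ u ∈ cell G l h c, ∃ v ∈ cell G l h d, G.Adj u v) ∧
    (∃ u ∈ cell G l h c, ∃ v ∈ cell G l h d, ¬ G.Adj u v)
  symm := ⟨by
    rintro c d ⟨hne, ⟨u, hu, v, hv, huv⟩, ⟨u', hu', v', hv', huv'⟩⟩
    exact ⟨hne.symm, ⟨v, hv, u, hu, huv.symm⟩, ⟨v', hv', u', hu', fun e => huv' e.symm⟩⟩⟩
  loopless := ⟨fun _ hc => hc.1 rfl⟩

/-- `c` may be the first cell processed in its anisotropic component: it has minimum size in the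
component and is heterogeneous if some cell of minimum size in the component is. -/
def IsComponentRoot {V L : Type*} [Fintype V] (G : SimpleGraph V) (l : V → L) (h : ℕ)
    (c : WLColour L h) : Prop :=
  (∀ d, (anisoGraph G l h).Reachable c d → (cell G l h c).ncard ≤ (cell G l h d).ncard) ∧
  ((∃ d, (anisoGraph G l h).Reachable c d ∧ (cell G l h d).ncard = (cell G l h c).ncard ∧
      Heterogeneous G l h d) → Heterogeneous G l h c)

/-- The colour `c` may be processed next, when the colours in `P` have been processed: either it has
an anisotropic edge to a processed colour, or no colour of its anisotropic component has been
processed and it is a possible start of the component. -/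
def MayProcess {V L : Type*} [Fintype V] (G : SimpleGraph V) (l : V → L) (h : ℕ)
    (P : Set (WLColour L h)) (c : WLColour L h) : Prop :=
  (∃ d ∈ P, (anisoGraph G l h).Adj d c) ∨
  ((∀ d ∈ P, ¬ (anisoGraph G l h).Reachable c d) ∧ IsComponentRoot G l h c)

/-! Pairing the objects at a node -/

/-- `X` pairs elements of `A` with elements of `B` one-to-one until one of the two sets is
exhausted. -/
structure IsPairing {α β : Type*} (A : Set α) (B : Set β) (X : Set (α × β)) : Prop where
  subset : X ⊆ A ×ˢ B
  left_unique : ∀ a b b', (a, b) ∈ X → (a, b') ∈ X → b = b'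
  right_unique : ∀ a a' b, (a, b) ∈ X → (a', b) ∈ X → a = a'
  exhausted : A ⊆ Prod.fst '' X ∨ B ⊆ Prod.snd '' X

/-- The new pairs `X` respect the edges between the newly matched vertices and the edges between
these and the vertices that were matched before (in `M`). -/
def RespectsEdges {V W : Type*} (G : SimpleGraph V) (H : SimpleGraph W)
    (M X : Set ((V ⊕ W) × (W ⊕ V))) : Prop :=
  ∀ a b a' b', (Sum.inl a, Sum.inl b) ∈ X → (Sum.inl a', Sum.inl b') ∈ X ∪ M →
    (G.Adj a a' ↔ H.Adj b b')

/-- A possible result of the modified pairing procedure: a pairing that respects the edges, or any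
pairing in case that none does. -/
def IsModifiedPairing {V W : Type*} (G : SimpleGraph V) (H : SimpleGraph W)
    (M : Set ((V ⊕ W) × (W ⊕ V))) (A : Set (V ⊕ W)) (B : Set (W ⊕ V))
    (X : Set ((V ⊕ W) × (W ⊕ V))) : Prop :=
  IsPairing A B X ∧
    ((∃ Y, IsPairing A B Y ∧ RespectsEdges G H M Y) → RespectsEdges G H M X)

/-! The algorithm -/

/-- A state: the remaining nodes of the tree, the unmatched objects held by each node, and the
partial assignment. -/
structure AssignState (V W L : Type*) where
  nodes : Set (WLNode L)
  A : WLNode L → Set (V ⊕ W)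
  B : WLNode L → Set (W ⊕ V)
  M : Set ((V ⊕ W) × (W ⊕ V))

/-- The state after the initialisation. -/
noncomputable def initialState {V W L : Type*} [Fintype V] [Fintype W]
    (G : SimpleGraph V) (lG : V → L) (H : SimpleGraph W) (lH : W → L) (h : ℕ) :
    AssignState V W L where
  nodes := wlTreeNodes G lG H lH h
  A := fun k => {a | objectNode G lG h a = k}
  B := fun k => {b | objectNode H lH h b = k}
  M := ∅

/-- The node `k` may be selected with respect to the order of the colour classes. Only the nodes of
the final colours are restricted. -/
def MaySelect {V L : Type*} [Fintype V] (G : SimpleGraph V) (l : V → L) (h : ℕ)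
    (nodes : Set (WLNode L)) (k : WLNode L) : Prop :=
  ∀ c, k = .colour h c → MayProcess G l h {d | WLNode.colour h d ∉ nodes} c

/-- One iteration of the main loop. In `leaf`, a node `k` with exactly one remaining neighbour `n`
is selected, objects at `k` are matched, the unmatched ones are passed to `n`, and `k` is removed.
In `last`, the objects at the only remaining node are matched and the node is removed. -/
inductive AssignStep {V W L : Type*} [Fintype V] [Fintype W]
    (G : SimpleGraph V) (lG : V → L) (H : SimpleGraph W) (h : ℕ) :
    AssignState V W L → AssignState V W L → Prop
  | leaf (s : AssignState V W L) (k n : WLNode L) (X : Set ((V ⊕ W) × (W ⊕ V)))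
      (hk : k ∈ s.nodes) (hn : n ∈ s.nodes) (hadj : (wlTree L).Adj k n)
      (huniq : ∀ n' ∈ s.nodes, (wlTree L).Adj k n' → n' = n)
      (hsel : MaySelect G lG h s.nodes k)
      (hX : IsModifiedPairing G H s.M (s.A k) (s.B k) X) :
      AssignStep G lG H h s
        { nodes := s.nodes \ {k}
          A := fun j => {a | a ∈ s.A j ∨ (j = n ∧ a ∈ s.A k ∧ a ∉ Prod.fst '' X)}
          B := fun j => {b | b ∈ s.B j ∨ (j = n ∧ b ∈ s.B k ∧ b ∉ Prod.snd '' X)}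
          M := s.M ∪ X }
  | last (s : AssignState V W L) (k : WLNode L) (X : Set ((V ⊕ W) × (W ⊕ V)))
      (hk : s.nodes = {k})
      (hsel : MaySelect G lG h s.nodes k)
      (hX : IsModifiedPairing G H s.M (s.A k) (s.B k) X) :
      AssignStep G lG H h s { nodes := ∅, A := s.A, B := s.B, M := s.M ∪ X }

/-- `M` is the output of a complete run of the algorithm (for some resolution of its choices). -/
def IsAlgorithmOutput {V W L : Type*} [Fintype V] [Fintype W]
    (G : SimpleGraph V) (lG : V → L) (H : SimpleGraph W) (lH : W → L) (h : ℕ)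
    (M : Set ((V ⊕ W) × (W ⊕ V))) : Prop :=
  ∃ s : AssignState V W L,
    Relation.ReflTransGen (AssignStep G lG H h) (initialState G lG H lH h) s ∧
    s.nodes = ∅ ∧ s.M = M

/-! Edit paths and their costs -/

/-- Edit operations: deletion, insertion and substitution of vertices and of edges. -/
inductive EditOp (V W : Type*) where
  | delVertex (v : V) : EditOp V W
  | insVertex (w : W) : EditOp V W
  | subVertex (v : V) (w : W) : EditOp V W
  | delEdge (e : Sym2 V) : EditOp V W
  | insEdge (f : Sym2 W) : EditOp V W
  | subEdge (e : Sym2 V) (f : Sym2 W) : EditOp V W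

/-- Non-zero edit costs, which may depend on the vertex labels. Only the substitution of a vertex by
one with the same label, and of an edge by an edge (edges have no labels), is free. -/
structure EditCosts (L : Type*) where
  delVertex : L → ℝ
  insVertex : L → ℝ
  subVertex : L → L → ℝ
  delEdge : ℝ
  insEdge : ℝ
  delVertex_pos : ∀ l, 0 < delVertex l
  insVertex_pos : ∀ l, 0 < insVertex l
  subVertex_self : ∀ l, subVertex l l = 0
  subVertex_pos : ∀ l l', l ≠ l' → 0 < subVertex l l'
  delEdge_pos : 0 < delEdge
  insEdge_pos : 0 < insEdge

/-- The cost of an edit operation. -/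
def EditCosts.cost {V W L : Type*} (C : EditCosts L) (lG : V → L) (lH : W → L) : EditOp V W → ℝ
  | .delVertex v => C.delVertex (lG v)
  | .insVertex w => C.insVertex (lH w)
  | .subVertex v w => C.subVertex (lG v) (lH w)
  | .delEdge _ => C.delEdge
  | .insEdge _ => C.insEdge
  | .subEdge _ _ => 0

/-- The assignment maps the endpoints of `e` to the endpoints of `f`. -/
def MapsPair {V W : Type*} (M : Set ((V ⊕ W) × (W ⊕ V))) (e : Sym2 V) (f : Sym2 W) : Prop :=
  ∃ a a' b b', e = s(a, a') ∧ f = s(b, b') ∧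
    (Sum.inl a, Sum.inl b) ∈ M ∧ (Sum.inl a', Sum.inl b') ∈ M

/-- The operations of the edit path from `G` to `H` that is induced by an assignment. (The order,
e.g. edge deletions first and edge insertions last, does not matter for the cost.) -/
def inducedEditPath {V W : Type*} (G : SimpleGraph V) (H : SimpleGraph W)
    (M : Set ((V ⊕ W) × (W ⊕ V))) : Set (EditOp V W) :=
  {o | match o with
    | .delVertex v => ∃ z, (Sum.inl v, Sum.inr z) ∈ M
    | .insVertex w => ∃ z, (Sum.inr z, Sum.inl w) ∈ M
    | .subVertex v w => (Sum.inl v, Sum.inl w) ∈ M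
    | .delEdge e => e ∈ G.edgeSet ∧ ∀ f ∈ H.edgeSet, ¬ MapsPair M e f
    | .insEdge f => f ∈ H.edgeSet ∧ ∀ e ∈ G.edgeSet, ¬ MapsPair M e f
    | .subEdge e f => e ∈ G.edgeSet ∧ f ∈ H.edgeSet ∧ MapsPair M e f}

/-- There are only finitely many edit operations, so that the sum below is a finite sum. -/
theorem finite_editOp (V W : Type*) [Finite V] [Finite W] : Finite (EditOp V W) := by
  let g : EditOp V W → V ⊕ W ⊕ (V × W) ⊕ Sym2 V ⊕ Sym2 W ⊕ (Sym2 V × Sym2 W) := fun o =>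
    match o with
    | .delVertex v => .inl v
    | .insVertex w => .inr (.inl w)
    | .subVertex v w => .inr (.inr (.inl (v, w)))
    | .delEdge e => .inr (.inr (.inr (.inl e)))
    | .insEdge f => .inr (.inr (.inr (.inr (.inl f))))
    | .subEdge e f => .inr (.inr (.inr (.inr (.inr (e, f)))))
  have : Finite (Sym2 V) := Quot.finite _
  have : Finite (Sym2 W) := Quot.finite _
  refine Finite.of_injective g ?_
  intro o o' hoo
  cases o <;> cases o' <;> simp_all [g]

/-- The cost of the induced edit path. -/
noncomputable def editPathCost {V W L : Type*} (C : EditCosts L)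
    (G : SimpleGraph V) (lG : V → L) (H : SimpleGraph W) (lH : W → L)
    (M : Set ((V ⊕ W) × (W ⊕ V))) : ℝ :=
  ∑ᶠ o ∈ inducedEditPath G H M, C.cost lG lH o

/-- `x` is a value of the approximate graph edit distance: the cost of the edit path induced by an
assignment that the algorithm computes. -/
def IsApproxGED {V W L : Type*} [Fintype V] [Fintype W] (C : EditCosts L)
    (G : SimpleGraph V) (lG : V → L) (H : SimpleGraph W) (lH : W → L) (h : ℕ) (x : ℝ) : Prop :=
  ∃ M, IsAlgorithmOutput G lG H lH h M ∧ editPathCost C G lG H lH M = x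

/-!
The existence of a complete run and the implication from cost zero to isomorphism hold for all
finite graphs. A run exists, since a leaf can always be selected: once no colour of the last round
is left, any node of maximum depth will do, and before that, if no remaining cell is joined to a
processed one, the remaining cells contain whole anisotropic components, and a suitable cell of
minimum size in one of them may be selected (`exists_isAlgorithmOutput`). An output is always a
one-to-one assignment of all objects (`consistent_of_run`), because both sides hold equally many
unmatched objects when only one node is left; if its edit path costs nothing, then it is an
isomorphism (`colouredIso_of_editPathCost_eq_zero`).

The remaining point is that the algorithm finds an isomorphism if there is one, and this is where
amenability is used, in the form `UniqueRealization`: every graph with the same numbers of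
neighbours in the stable cells is isomorphic to `G` by a map that preserves the cells. So the
edges between two cells may be rewired, and every isomorphism invariant of the coloured graph must
survive this.

* Rewiring the edges between two cells `d` and `e` that are joined by an anisotropic edge, with `d`
  not larger than `e`, shows that they form disjoint stars with centres in `d`, up to complementation
  (`UniqueRealization.exists_star_map`). Otherwise, after complementation if necessary, some graph
  with the same degrees has a component that is a complete bipartite graph `K`, and switching an
  edge of `K` against an edge outside of `K` yields one with fewer complete bipartite components
  (`UniqueBiregular.false_of_two_mul_le`).
* Suppose that each processed cell of an anisotropic component is mapped, by a map that is
  determined by the graph, to the cell `x` that was processed first, and that a new cell `c` of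
  the component has an anisotropic edge to a processed cell `d`. Permuting the leaves of the stars
  between `c` and `d` arbitrarily changes nothing else. Two regular graphs on the same set,
  neither of them empty or complete, can be overlaid with different numbers of common edges
  (`SimpleGraph.homogeneous_of_forall_overlay`), and a similar count applies to two maps onto `x`
  (`exists_card_agree_ne`). It follows that `c` is not smaller than `d`
  (`IsRootMap.ncard_cell_le`), that `c` is homogeneous (`IsRootMap.not_heterogeneous`) and that
  `d` is unique (`IsRootMap.eq_of_adj`). The choice of `x` as a cell of minimum size, and a
  heterogeneous one if possible, enters here.
* Hence `c` consists of the leaves of stars of equal size around the vertices of `d` and has no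
  other relevant edges, so that every partial isomorphism on the processed cells extends to `c`
  (`IsRootMap.exists_extension`). The pairing at `c` can therefore respect the edges, and the
  algorithm keeps extending a partial isomorphism (`AssignState.PartialIso`).
-/

/-! ### Cell degrees and unique realizations -/

section Realization

variable {V K : Type*}

/-- The number of neighbours of `v` that have colour `d`. -/
noncomputable def cellDegree (G : SimpleGraph V) (c : V → K) (v : V) (d : K) : ℕ :=
  {w | G.Adj v w ∧ c w = d}.ncard

/-- The colouring `c` is equitable for `G`, and `G` is, up to isomorphisms that preserve `c`, the
only graph on its vertex set with the given numbers of neighbours in the colour classes. -/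
structure UniqueRealization (G : SimpleGraph V) (c : V → K) : Prop where
  equitable : ∀ u v, c u = c v → ∀ d, cellDegree G c u d = cellDegree G c v d
  unique : ∀ G' : SimpleGraph V, (∀ v d, cellDegree G' c v d = cellDegree G c v d) →
    ∃ f : G ≃g G', ∀ v, c (f v) = c v

end Realization

/-! ### Colour refinement -/

section Refinement

variable {V W L : Type*} [Fintype V] [Fintype W]

theorem wlColour_iso {G : SimpleGraph V} {lG : V → L} {H : SimpleGraph W} {lH : W → L}
    (f : G ≃g H) (hf : ∀ v, lH (f v) = lG v) (i : ℕ) (v : V) :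
    wlColour H lH i (f v) = wlColour G lG i v := by
  classical
  induction i generalizing v with
  | zero => exact hf v
  | succ i ih =>
    have hnb : (Finset.univ.filter fun u => H.Adj (f v) u) =
        (Finset.univ.filter fun u => G.Adj v u).map f.toEquiv.toEmbedding := by
      ext u
      simp only [Finset.mem_filter, Finset.mem_univ, true_and, Finset.mem_map]
      constructor
      · intro hu
        refine ⟨f.symm u, ?_, by simp⟩
        rw [← f.map_adj_iff]
        simpa using hu
      · rintro ⟨w, hw, rfl⟩
        exact f.map_adj_iff.2 hw
    simp only [wlColour]
    refine Prod.ext (ih v) ?_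
    change Multiset.map _ (Finset.val _) = Multiset.map _ (Finset.val _)
    convert congrArg (Multiset.map (wlColour H lH i)) (congrArg Finset.val hnb) using 1
    rw [Finset.map_val, Multiset.map_map]
    exact Multiset.map_congr rfl fun w _ => (ih w).symm

theorem ColouredIso.wlEquivalent {G : SimpleGraph V} {lG : V → L} {H : SimpleGraph W} {lH : W → L}
    (hGH : ColouredIso G lG H lH) : WLEquivalent G lG H lH := by
  obtain ⟨f, hf⟩ := hGH
  intro i
  rw [← Finset.map_univ_equiv f.toEquiv, Finset.map_val, Multiset.map_map]
  exact Multiset.map_congr rfl fun w _ => (wlColour_iso f hf i w).symm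

theorem label_eq_of_wlColour_eq {G : SimpleGraph V} {lG : V → L} {H : SimpleGraph W} {lH : W → L}
    {i : ℕ} {v : V} {w : W} (hvw : wlColour G lG i v = wlColour H lH i w) : lG v = lH w := by
  induction i with
  | zero => exact hvw
  | succ i ih => exact ih (congrArg Prod.fst hvw)

theorem count_map_neighbours (G : SimpleGraph V) (l : V → L) (i : ℕ) (v : V) (d : WLColour L i)
    [DecidableEq (WLColour L i)] [DecidablePred fun u => G.Adj v u] :
    Multiset.count d ((Finset.univ.filter fun u => G.Adj v u).val.map (wlColour G l i)) =
      cellDegree G (wlColour G l i) v d := by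
  classical
  rw [Multiset.count_map, cellDegree, Set.ncard_eq_toFinset_card', ← Finset.filter_val,
    Finset.card_val]
  congr 1
  ext u
  simp [eq_comm]

theorem cellDegree_eq_of_wlColour_succ_eq {G : SimpleGraph V} {l : V → L} {i : ℕ} {u v : V}
    (huv : wlColour G l (i + 1) u = wlColour G l (i + 1) v) (d : WLColour L i) :
    cellDegree G (wlColour G l i) u d = cellDegree G (wlColour G l i) v d := by
  classical
  rw [← count_map_neighbours, ← count_map_neighbours]
  exact congrArg (Multiset.count d) (congrArg Prod.snd huv)

theorem wlColour_succ_eq_iff {G : SimpleGraph V} {l : V → L} {i : ℕ} {u v : V} :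
    wlColour G l (i + 1) u = wlColour G l (i + 1) v ↔ wlColour G l i u = wlColour G l i v ∧
      ∀ d, cellDegree G (wlColour G l i) u d = cellDegree G (wlColour G l i) v d := by
  classical
  refine ⟨fun huv => ⟨congrArg Prod.fst huv, cellDegree_eq_of_wlColour_succ_eq huv⟩, fun huv => ?_⟩
  refine Prod.ext huv.1 (Multiset.ext.2 fun d => ?_)
  have := huv.2 d
  rwa [← count_map_neighbours, ← count_map_neighbours] at this

/-- Cell degrees with respect to a finer colouring determine those with respect to a coarser one,
also for two different graphs. -/
theorem cellDegree_eq_of_factor {K K' : Type*} {G G' : SimpleGraph V} {c : V → K} {c' : V → K'}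
    (hc : ∀ u v, c u = c v → c' u = c' v) {u v : V}
    (huv : ∀ d, cellDegree G c u d = cellDegree G' c v d) (d : K') :
    cellDegree G c' u d = cellDegree G' c' v d := by
  classical
  have key : ∀ (G : SimpleGraph V) (v : V), cellDegree G c' v d =
      ∑ k ∈ (Finset.univ.filter fun w => c' w = d).image c, cellDegree G c v k := by
    intro G v
    have hcard : ∀ k, cellDegree G c v k =
        (Finset.univ.filter fun w => G.Adj v w ∧ c w = k).card := by
      intro k
      rw [cellDegree, Set.ncard_eq_toFinset_card']
      congr 1
      ext; simp
    simp only [hcard]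
    rw [cellDegree, Set.ncard_eq_toFinset_card',
      Finset.card_eq_sum_card_fiberwise (f := c)
        (t := (Finset.univ.filter fun w => c' w = d).image c)]
    · refine Finset.sum_congr rfl fun k hk => ?_
      congr 1
      ext w
      simp only [Finset.mem_image, Finset.mem_filter, Finset.mem_univ, true_and] at hk
      obtain ⟨w', hw', rfl⟩ := hk
      simp only [Finset.mem_filter, Set.mem_toFinset, Set.mem_ofPred_eq, Finset.mem_univ, true_and]
      exact ⟨fun hw => ⟨hw.1.1, hw.2⟩, fun hw => ⟨⟨hw.1, (hc _ _ hw.2).trans hw'⟩, hw.2⟩⟩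
    · intro w hw
      simp only [Set.mem_toFinset, Set.mem_ofPred_eq, Finset.coe_image,
        Finset.mem_coe, Set.mem_image] at hw ⊢
      exact ⟨w, by simpa using hw.2, rfl⟩
  rw [key, key]
  exact Finset.sum_congr rfl fun k _ => huv k

/-- Every round of refinement is coarser than a stable one. -/
theorem StableAt.wlColour_eq {G : SimpleGraph V} {l : V → L} {h : ℕ} (hs : StableAt G l h) (i : ℕ)
    {u v : V} (huv : wlColour G l h u = wlColour G l h v) :
    wlColour G l i u = wlColour G l i v := by
  have hle : ∀ k, ∀ i, wlColour G l (i + k) u = wlColour G l (i + k) v →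
      wlColour G l i u = wlColour G l i v := by
    intro k
    induction k with
    | zero => exact fun i hi => hi
    | succ k ih => exact fun i hi => ih i (congrArg Prod.fst hi)
  have hge : ∀ k, ∀ u v, wlColour G l h u = wlColour G l h v →
      wlColour G l (h + k) u = wlColour G l (h + k) v := by
    intro k
    induction k with
    | zero => exact fun u v huv => huv
    | succ k ih =>
      intro u v huv
      exact wlColour_succ_eq_iff.2 ⟨ih u v huv, cellDegree_eq_of_factor ih
        (cellDegree_eq_of_wlColour_succ_eq ((hs u v).1 huv))⟩
  rcases le_total i h with hi | hi
  · obtain ⟨k, rfl⟩ := Nat.exists_eq_add_of_le hi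
    exact hle k i huv
  · obtain ⟨k, rfl⟩ := Nat.exists_eq_add_of_le hi
    exact hge k u v huv

/-- A graph with the same numbers of neighbours in the stable cells gets the same colours. -/
theorem StableAt.wlColour_eq_of_cellDegree_eq {G G' : SimpleGraph V} {l : V → L} {h : ℕ}
    (hs : StableAt G l h)
    (hd : ∀ v d, cellDegree G' (wlColour G l h) v d = cellDegree G (wlColour G l h) v d) (i : ℕ) :
    wlColour G' l i = wlColour G l i := by
  classical
  induction i with
  | zero => rfl
  | succ i ih =>
    funext v
    refine Prod.ext (congrFun ih v) (Multiset.ext.2 fun d => ?_)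
    have := cellDegree_eq_of_factor (fun u v => hs.wlColour_eq i (u := u) (v := v)) (hd v) d
    rw [← count_map_neighbours, ← ih, ← count_map_neighbours] at this
    exact this.trans (by rw [ih]; rfl)

/-- Any graph on the vertices of an amenable graph with the same numbers of neighbours in the stable
cells is indistinguishable from it by colour refinement, and hence isomorphic to it. -/
theorem Amenable.uniqueRealization {G : SimpleGraph V} {l : V → L} (hG : Amenable G l) {h : ℕ}
    (hs : StableAt G l h) : UniqueRealization G (wlColour G l h) where
  equitable u v huv := cellDegree_eq_of_wlColour_succ_eq ((hs u v).1 huv)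
  unique G' hd := by
    have hcol := hs.wlColour_eq_of_cellDegree_eq hd
    let e := Fintype.equivFin V
    let φ : G'.comap e.symm ≃g G' := SimpleGraph.Iso.comap e.symm G'
    have hφ : WLEquivalent G l (G'.comap e.symm) (l ∘ e.symm) := by
      have h1 : ColouredIso (G'.comap e.symm) (l ∘ e.symm) G' l := ⟨φ, fun _ => rfl⟩
      intro i
      rw [h1.wlEquivalent i, hcol]
    obtain ⟨f, hf⟩ := (hG _ _ _).1 hφ
    refine ⟨f.trans φ, fun v => ?_⟩
    have := wlColour_iso (lG := l) (lH := l) (f.trans φ) hf h v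
    rwa [hcol] at this

end Refinement

/-! ### Biregular bipartite graphs with a unique realization -/

section Biregular

variable {α β : Type*}

/-- The relation `R` between `α` and `β`, seen as a bipartite graph, has degree `a` on the side of
`α` and degree `b` on the side of `β`. -/
structure Biregular (R : α → β → Prop) (a b : ℕ) : Prop where
  left : ∀ x, Nat.card {y // R x y} = a
  right : ∀ y, Nat.card {x // R x y} = b

theorem card_subtype_congr {p q : α → Prop} (e : Equiv.Perm α) (he : ∀ x, p x ↔ q (e x)) :
    Nat.card {x // p x} = Nat.card {x // q x} :=
  Nat.card_congr (e.subtypeEquiv he)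

theorem exists_ne_of_two_le_card {p : α → Prop} (hp : 2 ≤ Nat.card {x // p x}) (z : α) :
    ∃ x, p x ∧ x ≠ z := by
  have : Finite {x // p x} := Nat.finite_of_card_ne_zero (by omega)
  have : Nontrivial {x // p x} := Finite.one_lt_card_iff_nontrivial.1 hp
  obtain ⟨x, y, hxy⟩ := exists_pair_ne {x // p x}
  by_cases hx : x.1 = z
  · exact ⟨y.1, y.2, fun hy => hxy (Subtype.ext (hx.trans hy.symm))⟩
  · exact ⟨x.1, x.2, hx⟩

/-- Count the edges twice by the numbers `0, …, m * a - 1 = n * b - 1`: edge `k` joins the quotient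
of `k` by `a` to the residue of `k` modulo `n`. -/
theorem exists_biregular_fin {m n a b : ℕ} (hmn : m * a = n * b) (ha : a ≤ n) :
    ∃ R : Fin m → Fin n → Prop, Biregular R a b := by
  refine ⟨fun i j => ∃ s < a, ∃ t < b, (i : ℕ) * a + s = j + n * t, fun i => ?_, fun j => ?_⟩
  · have hlt : ∀ s < a, (i : ℕ) * a + s < n * b := fun s hs => by
      have h1 : ((i : ℕ) + 1) * a ≤ m * a := Nat.mul_le_mul_right _ i.2
      rw [hmn, Nat.add_mul] at h1
      omega
    let f : Fin a → {j : Fin n // ∃ s < a, ∃ t < b, (i : ℕ) * a + s = j + n * t} := fun s =>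
      ⟨⟨((i : ℕ) * a + s) % n, Nat.mod_lt _ (by have := s.2; omega)⟩, s, s.2,
        ((i : ℕ) * a + s) / n, Nat.div_lt_of_lt_mul (hlt s s.2), (Nat.mod_add_div _ _).symm⟩
    have hf : Function.Bijective f := by
      constructor
      · intro s s' hs
        have h1 : (i : ℕ) * a + s ≡ (i : ℕ) * a + s' [MOD n] := by
          simpa [f, Nat.ModEq] using hs
        exact Fin.ext ((Nat.ModEq.add_left_cancel' _ h1).eq_of_lt_of_lt
          (s.2.trans_le ha) (s'.2.trans_le ha))
      · rintro ⟨j, s, hs, t, ht, hst⟩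
        refine ⟨⟨s, hs⟩, Subtype.ext (Fin.ext ?_)⟩
        simp only [f, hst, Nat.add_mul_mod_self_left]
        exact Nat.mod_eq_of_lt j.2
    rw [← Nat.card_congr (Equiv.ofBijective f hf), Nat.card_fin]
  · have hlt : ∀ t < b, (j : ℕ) + n * t < m * a := fun t ht => by
      have h1 : n * (t + 1) ≤ n * b := Nat.mul_le_mul_left _ ht
      have h2 := j.2
      rw [← hmn, Nat.mul_add] at h1
      omega
    have hpos : ∀ t < b, 0 < a := fun t ht => by
      rcases Nat.eq_zero_or_pos a with h0 | h0
      · have := hlt t ht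
        simp [h0] at this
      · exact h0
    let f : Fin b → {i : Fin m // ∃ s < a, ∃ t < b, (i : ℕ) * a + s = j + n * t} := fun t =>
      ⟨⟨((j : ℕ) + n * t) / a, Nat.div_lt_of_lt_mul ((hlt t t.2).trans_eq (mul_comm _ _))⟩,
        ((j : ℕ) + n * t) % a, Nat.mod_lt _ (hpos t t.2), t, t.2, by
          rw [mul_comm]; exact Nat.div_add_mod _ _⟩
    have hlt' : ∀ t t' : Fin b, (t : ℕ) < t' → ((j : ℕ) + n * t) / a < ((j : ℕ) + n * t') / a := by
      intro t t' htt
      have h1 : n * ((t : ℕ) + 1) ≤ n * t' := Nat.mul_le_mul_left _ htt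
      have h2 : ((j : ℕ) + n * t + a) / a ≤ ((j : ℕ) + n * t') / a :=
        Nat.div_le_div_right (by rw [Nat.mul_add] at h1; omega)
      rw [Nat.add_div_right _ (hpos t t.2)] at h2
      omega
    have hf : Function.Bijective f := by
      constructor
      · intro t t' ht
        have h1 : ((j : ℕ) + n * t) / a = ((j : ℕ) + n * t') / a := by simpa [f] using ht
        rcases lt_trichotomy (t : ℕ) t' with h2 | h2 | h2
        · have := hlt' _ _ h2
          omega
        · exact Fin.ext h2
        · have := hlt' _ _ h2
          omega
      · rintro ⟨i, s, hs, t, ht, hst⟩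
        refine ⟨⟨t, ht⟩, Subtype.ext (Fin.ext ?_)⟩
        simp only [f, ← hst]
        rw [mul_comm, Nat.mul_add_div (by omega), Nat.div_eq_of_lt hs, add_zero]
    rw [← Nat.card_congr (Equiv.ofBijective f hf), Nat.card_fin]

theorem exists_biregular [Finite α] [Finite β] {a b : ℕ}
    (hab : Nat.card α * a = Nat.card β * b) (ha : a ≤ Nat.card β) :
    ∃ R : α → β → Prop, Biregular R a b := by
  obtain ⟨R, hl, hr⟩ := exists_biregular_fin hab ha
  let e := Finite.equivFin α
  let e' := Finite.equivFin β
  refine ⟨fun x y => R (e x) (e' y), fun x => ?_, fun y => ?_⟩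
  · rw [← hl (e x)]
    exact Nat.card_congr (e'.subtypeEquiv fun _ => Iff.rfl)
  · rw [← hr (e' y)]
    exact Nat.card_congr (e.subtypeEquiv fun _ => Iff.rfl)

/-- If the degrees are at most half of the sizes of the sides, then there is a biregular graph that
has a complete bipartite graph as a connected component. -/
theorem exists_biregular_with_complete_component [Finite α] [Finite β] {a b : ℕ}
    (hab : Nat.card α * a = Nat.card β * b) (ha : 2 * a ≤ Nat.card β) (hb : b ≤ Nat.card α) :
    ∃ (R : α → β → Prop) (A : Set α) (B : Set β), Biregular R a b ∧ A.ncard = b ∧ B.ncard = a ∧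
      (∀ x ∈ A, ∀ y, R x y ↔ y ∈ B) ∧ (∀ y ∈ B, ∀ x, R x y ↔ x ∈ A) := by
  classical
  obtain ⟨A, -, hA⟩ := Set.exists_subset_card_eq (s := (Set.univ : Set α)) (n := b)
    (by rwa [Set.ncard_univ])
  obtain ⟨B, -, hB⟩ := Set.exists_subset_card_eq (s := (Set.univ : Set β)) (n := a)
    (by rw [Set.ncard_univ]; omega)
  have hAc : Nat.card {x // x ∉ A} = Nat.card α - b := by
    rw [← hA, ← Set.ncard_compl]; rfl
  have hBc : Nat.card {y // y ∉ B} = Nat.card β - a := by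
    rw [← hB, ← Set.ncard_compl]; rfl
  obtain ⟨R, hl, hr⟩ := exists_biregular (α := {x // x ∉ A}) (β := {y // y ∉ B}) (a := a) (b := b)
    (by rw [hAc, hBc, Nat.sub_mul, Nat.sub_mul, hab, mul_comm a b]) (by omega)
  refine ⟨fun x y => (x ∈ A ∧ y ∈ B) ∨ ∃ (hx : x ∉ A) (hy : y ∉ B), R ⟨x, hx⟩ ⟨y, hy⟩, A, B,
    ⟨fun x => ?_, fun y => ?_⟩, hA, hB, fun x hx y => by simp [hx], fun y hy x => by simp [hy]⟩
  · by_cases hx : x ∈ A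
    · simp only [hx, true_and, not_true_eq_false, IsEmpty.exists_iff, or_false]
      exact hB
    · rw [← hl ⟨x, hx⟩]
      refine Nat.card_congr ⟨fun y => ⟨⟨y.1, ?_⟩, ?_⟩, fun y => ⟨y.1.1, ?_⟩, fun _ => rfl,
        fun _ => rfl⟩
      · rcases y.2 with h1 | h1
        · exact absurd h1.1 hx
        · exact h1.2.1
      · rcases y.2 with h1 | h1
        · exact absurd h1.1 hx
        · exact h1.2.2
      · exact Or.inr ⟨hx, y.1.2, y.2⟩
  · by_cases hy : y ∈ B
    · simp only [hy, and_true, not_true_eq_false, IsEmpty.exists_iff, or_false, exists_false]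
      exact hA
    · rw [← hr ⟨y, hy⟩]
      refine Nat.card_congr ⟨fun x => ⟨⟨x.1, ?_⟩, ?_⟩, fun x => ⟨x.1.1, ?_⟩, fun _ => rfl,
        fun _ => rfl⟩
      · rcases x.2 with h1 | h1
        · exact absurd h1.2 hy
        · exact h1.1
      · rcases x.2 with h1 | h1
        · exact absurd h1.2 hy
        · exact h1.2.2
      · exact Or.inr ⟨x.1.2, hy, x.2⟩

/-- The connected component of `x` is a complete bipartite graph. -/
def InCompleteComponent (R : α → β → Prop) (x : α) : Prop :=
  ∀ y y', R x y → R x y' → ∀ x', R x' y ↔ R x' y'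

theorem ncard_inCompleteComponent_congr {R R' : α → β → Prop} (e : Equiv.Perm α)
    (e' : Equiv.Perm β) (he : ∀ x y, R' (e x) (e' y) ↔ R x y) :
    {x | InCompleteComponent R x}.ncard = {x | InCompleteComponent R' x}.ncard := by
  refine card_subtype_congr e fun x => ?_
  simp only [Set.mem_ofPred_eq]
  constructor
  · intro hx y y' hy hy' x'
    have h1 := hx (e'.symm y) (e'.symm y') (by rw [← he]; simpa) (by rw [← he]; simpa) (e.symm x')
    rw [← he, ← he] at h1
    simpa using h1
  · intro hx y y' hy hy' x'
    rw [← he, ← he]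
    exact hx _ _ ((he _ _).2 hy) ((he _ _).2 hy') _

/-- Switching an edge of a complete bipartite component `A × B` against an edge outside of it
destroys this component and creates no new complete bipartite component, while the degrees stay the
same. -/
theorem exists_switch [Finite α] {R : α → β → Prop} {a b : ℕ} (hR : Biregular R a b)
    {A : Set α} {B : Set β} (hA : A.ncard = b) (hB : B.ncard = a) (ha : 2 ≤ a) (hb : 2 ≤ b)
    (hcard : b < Nat.card α) (hAB : ∀ x ∈ A, ∀ y, R x y ↔ y ∈ B)
    (hBA : ∀ y ∈ B, ∀ x, R x y ↔ x ∈ A) :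
    ∃ R' : α → β → Prop, Biregular R' a b ∧
      {x | InCompleteComponent R' x}.ncard < {x | InCompleteComponent R x}.ncard := by
  classical
  have hBfin : B.Finite := Set.finite_of_ncard_ne_zero (by omega)
  obtain ⟨x₀, hx₀⟩ := Set.nonempty_of_ncard_ne_zero (s := A) (by omega)
  obtain ⟨y₀, hy₀⟩ := Set.nonempty_of_ncard_ne_zero (s := B) (by omega)
  have hA2 : ∃ x ∈ A, x ≠ x₀ := Set.exists_ne_of_one_lt_ncard (by omega) x₀
  have hB2 : ∃ y ∈ B, y ≠ y₀ := Set.exists_ne_of_one_lt_ncard (by omega) y₀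
  obtain ⟨x₁, hx₁, hx₁₀⟩ := hA2
  obtain ⟨y₁, hy₁, hy₁₀⟩ := hB2
  obtain ⟨x₂, hx₂⟩ : ∃ x, x ∉ A := by
    by_contra! hall
    rw [Set.eq_univ_of_forall hall, Set.ncard_univ] at hA
    omega
  obtain ⟨y₂, hxy₂, -⟩ := exists_ne_of_two_le_card (p := R x₂) (by rw [hR.left]; omega) y₀
  have hy₂ : y₂ ∉ B := fun hy => hx₂ ((hBA y₂ hy x₂).1 hxy₂)
  have hx₂₀ : x₂ ≠ x₀ := fun e => hx₂ (e ▸ hx₀)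
  have hy₂₀ : y₂ ≠ y₀ := fun e => hy₂ (e ▸ hy₀)
  have r00 : R x₀ y₀ := (hAB _ hx₀ _).2 hy₀
  have r02 : ¬ R x₀ y₂ := fun hr => hy₂ ((hAB _ hx₀ _).1 hr)
  have r20 : ¬ R x₂ y₀ := fun hr => hx₂ ((hBA _ hy₀ _).1 hr)
  let R' : α → β → Prop := fun x y =>
    if (x = x₀ ∨ x = x₂) ∧ (y = y₀ ∨ y = y₂) then ¬ R x y else R x y
  have hrow : ∀ x y, x ≠ x₀ → x ≠ x₂ → (R' x y ↔ R x y) := fun x y h1 h2 => by simp [R', h1, h2]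
  have hcol : ∀ x y, y ≠ y₀ → y ≠ y₂ → (R' x y ↔ R x y) := fun x y h1 h2 => by simp [R', h1, h2]
  have r00' : ¬ R' x₀ y₀ := by simp [R', r00]
  have r02' : R' x₀ y₂ := by simp [R', r02]
  have r20' : R' x₂ y₀ := by simp [R', r20]
  have r22' : ¬ R' x₂ y₂ := by simp [R', hxy₂]
  refine ⟨R', ⟨fun x => ?_, fun y => ?_⟩, ?_⟩
  · rw [← hR.left x]
    by_cases hx : x = x₀ ∨ x = x₂
    · refine card_subtype_congr (Equiv.swap y₀ y₂) fun y => ?_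
      by_cases hy0 : y = y₀
      · subst hy0
        rcases hx with rfl | rfl <;> simp [*]
      by_cases hy2 : y = y₂
      · subst hy2
        rcases hx with rfl | rfl <;> simp [*]
      rw [Equiv.swap_apply_of_ne_of_ne hy0 hy2, hcol _ _ hy0 hy2]
    · push Not at hx
      exact card_subtype_congr (Equiv.refl _) fun y => hrow x y hx.1 hx.2
  · rw [← hR.right y]
    by_cases hy : y = y₀ ∨ y = y₂
    · refine card_subtype_congr (Equiv.swap x₀ x₂) fun x => ?_
      by_cases hx0 : x = x₀
      · subst hx0
        rcases hy with rfl | rfl <;> simp [*]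
      by_cases hx2 : x = x₂
      · subst hx2
        rcases hy with rfl | rfl <;> simp [*]
      rw [Equiv.swap_apply_of_ne_of_ne hx0 hx2, hrow _ _ hx0 hx2]
    · push Not at hy
      exact card_subtype_congr (Equiv.refl _) fun x => hcol x y hy.1 hy.2
  · refine Set.ncard_lt_ncard (Set.ssubset_iff_exists.2 ⟨?_, x₀, ?_, ?_⟩) (Set.toFinite _)
    · intro x hx
      simp only [Set.mem_ofPred_eq] at hx ⊢
      by_cases hxA : x ∈ A
      · intro y y' hy hy' x'
        rw [hBA y ((hAB x hxA y).1 hy), hBA y' ((hAB x hxA y').1 hy')]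
      have hx0 : x ≠ x₀ := fun e => hxA (e ▸ hx₀)
      have hout : ∀ y, R x y → y ≠ y₀ := fun y hy e => hxA ((hBA y₀ hy₀ x).1 (e ▸ hy))
      by_cases hx2 : x = x₂
      · -- the old neighbours of `x₂` are not adjacent to `x₁`, the new neighbour `y₀` is
        subst hx2
        obtain ⟨y, hy, hyy⟩ := exists_ne_of_two_le_card (p := R x) (by rw [hR.left]; omega) y₂
        have h1 := (hx y y₀ ((hcol _ _ (hout y hy) hyy).2 hy) r20' x₁).2
          ((hrow x₁ y₀ hx₁₀ (fun e => hx₂ (e ▸ hx₁))).2 ((hBA _ hy₀ _).2 hx₁))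
        have h2 := (hAB x₁ hx₁ y).1 ((hcol _ _ (hout y hy) hyy).1 h1)
        exact absurd ((hBA y h2 x).1 hy) hxA
      · -- `x` has its old neighbours, and `y₂` is the only one that is now adjacent to `x₀`
        have hx0' : ∀ y, R x y → y ≠ y₂ → ¬ R' x₀ y := fun y hy h2 h3 =>
          hxA ((hBA y ((hAB x₀ hx₀ y).1 ((hcol _ _ (hout y hy) h2).1 h3)) x).1 hy)
        intro y y' hy hy' x'
        have h1 := fun z => hx y y' ((hrow _ _ hx0 hx2).2 hy) ((hrow _ _ hx0 hx2).2 hy') z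
        by_cases hy2 : y = y₂ <;> by_cases hy2' : y' = y₂
        · rw [hy2, hy2']
        · exact absurd ((h1 x₀).1 (hy2 ▸ r02')) (hx0' y' hy' hy2')
        · exact absurd ((h1 x₀).2 (hy2' ▸ r02')) (hx0' y hy hy2)
        · rw [← hcol _ _ (hout y hy) hy2, ← hcol _ _ (hout y' hy') hy2']
          exact h1 x'
    · intro y y' hy hy' x'
      rw [hBA y ((hAB _ hx₀ y).1 hy), hBA y' ((hAB _ hx₀ y').1 hy')]
    · intro hx
      have h1 : y₁ ≠ y₂ := fun e => hy₂ (e ▸ hy₁)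
      have h2 := (hx y₁ y₂ ((hcol _ _ hy₁₀ h1).2 ((hAB _ hx₀ _).2 hy₁)) r02' x₁).1
        ((hcol _ _ hy₁₀ h1).2 ((hAB _ hx₁ _).2 hy₁))
      exact hy₂ ((hAB _ hx₁ _).1 ((hrow _ _ hx₁₀ (fun e => hx₂ (e ▸ hx₁))).1 h2))

theorem Biregular.card_mul [Finite α] [Finite β] {R : α → β → Prop} {a b : ℕ}
    (hR : Biregular R a b) : Nat.card α * a = Nat.card β * b := by
  classical
  have := Fintype.ofFinite α
  have := Fintype.ofFinite β
  have h1 := Finset.sum_card_bipartiteAbove_eq_sum_card_bipartiteBelow R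
    (s := Finset.univ) (t := Finset.univ)
  have h2 : ∀ x, (Finset.bipartiteAbove R Finset.univ x).card = a := fun x => by
    rw [← hR.left x, Nat.card_eq_fintype_card, Fintype.card_subtype]; rfl
  have h3 : ∀ y, (Finset.bipartiteBelow R Finset.univ y).card = b := fun y => by
    rw [← hR.right y, Nat.card_eq_fintype_card, Fintype.card_subtype]; rfl
  simpa [h2, h3] using h1

theorem Biregular.compl [Finite α] [Finite β] {R : α → β → Prop} {a b : ℕ} (hR : Biregular R a b) :
    Biregular (fun x y => ¬ R x y) (Nat.card β - a) (Nat.card α - b) where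
  left x := by
    rw [← hR.left x]
    exact Set.ncard_compl {y | R x y}
  right y := by
    rw [← hR.right y]
    exact Set.ncard_compl {x | R x y}

/-- `R` has degrees `a` and `b` and is the only such relation between `α` and `β`, up to
permutations of both sides. -/
def UniqueBiregular (R : α → β → Prop) (a b : ℕ) : Prop :=
  Biregular R a b ∧ ∀ R' : α → β → Prop, Biregular R' a b →
    ∃ (e : Equiv.Perm α) (e' : Equiv.Perm β), ∀ x y, R' (e x) (e' y) ↔ R x y

/-- The number of vertices in complete bipartite components would be the same for all relations with
the given degrees, but `exists_switch` changes it. -/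
theorem UniqueBiregular.false_of_two_mul_le [Finite α] [Finite β] {R : α → β → Prop} {a b : ℕ}
    (hR : UniqueBiregular R a b) (ha : 2 ≤ a) (hb : 2 ≤ b) (ha' : 2 * a ≤ Nat.card β)
    (hb' : b < Nat.card α) : False := by
  obtain ⟨R₁, A, B, hR₁, hA, hB, hAB, hBA⟩ :=
    exists_biregular_with_complete_component hR.1.card_mul ha' hb'.le
  obtain ⟨R₂, hR₂, hlt⟩ := exists_switch hR₁ hA hB ha hb hb' hAB hBA
  obtain ⟨e₁, e₁', he₁⟩ := hR.2 R₁ hR₁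
  obtain ⟨e₂, e₂', he₂⟩ := hR.2 R₂ hR₂
  rw [← ncard_inCompleteComponent_congr e₁ e₁' he₁,
    ← ncard_inCompleteComponent_congr e₂ e₂' he₂] at hlt
  exact lt_irrefl _ hlt

theorem UniqueBiregular.compl [Finite α] [Finite β] {R : α → β → Prop} {a b : ℕ}
    (hR : UniqueBiregular R a b) (ha : a ≤ Nat.card β) (hb : b ≤ Nat.card α) :
    UniqueBiregular (fun x y => ¬ R x y) (Nat.card β - a) (Nat.card α - b) := by
  refine ⟨hR.1.compl, fun R' hR' => ?_⟩
  have h1 := hR'.compl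
  rw [Nat.sub_sub_self ha, Nat.sub_sub_self hb] at h1
  obtain ⟨e, e', he⟩ := hR.2 _ h1
  exact ⟨e, e', fun x y => by simp only [← he, not_not]⟩

/-- A biregular bipartite graph that is determined by its degrees and is neither empty nor complete
is a disjoint union of stars with centres on the smaller side, or the complement of one. -/
theorem UniqueBiregular.degree_cases [Finite α] [Finite β] {R : α → β → Prop} {a b : ℕ}
    (hR : UniqueBiregular R a b) (hβ : 0 < Nat.card β) (hle : Nat.card α ≤ Nat.card β)
    (hb0 : 0 < b) (hb : b < Nat.card α) : b = 1 ∨ b + 1 = Nat.card α := by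
  by_contra! hne
  have hm := hR.1.card_mul
  have hab : b ≤ a := by
    by_contra! hlt
    have h1 : Nat.card α * a < Nat.card β * b :=
      (Nat.mul_le_mul_right a hle).trans_lt (Nat.mul_lt_mul_of_pos_left hlt hβ)
    omega
  have haβ : a < Nat.card β := by
    by_contra! hlt
    have h1 : Nat.card β * b < Nat.card β * Nat.card α := Nat.mul_lt_mul_of_pos_left hb hβ
    have h2 : Nat.card α * Nat.card β ≤ Nat.card α * a := Nat.mul_le_mul_left _ hlt
    rw [mul_comm (Nat.card β) (Nat.card α)] at h1
    omega
  rcases Nat.le_total (2 * a) (Nat.card β) with h2 | h2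
  · exact hR.false_of_two_mul_le (by omega) (by omega) h2 hb
  · have hc := hR.compl haβ.le hb.le
    have hm' := hc.1.card_mul
    have hab' : Nat.card α - b ≤ Nat.card β - a := by
      by_contra! hlt
      have h1 : Nat.card α * (Nat.card β - a) < Nat.card β * (Nat.card α - b) :=
        (Nat.mul_le_mul_right _ hle).trans_lt (Nat.mul_lt_mul_of_pos_left hlt hβ)
      omega
    exact hc.false_of_two_mul_le (by omega) (by omega) (by omega) (by omega)

end Biregular

/-! ### Overlaying two structures on a finite set -/

section Overlay

variable {Y : Type*}

theorem exists_perm_four {a b c d a' b' c' d' : Y} (h : [a, b, c, d].Nodup)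
    (h' : [a', b', c', d'].Nodup) :
    ∃ σ : Equiv.Perm Y, σ a = a' ∧ σ b = b' ∧ σ c = c' ∧ σ d = d' := by
  obtain ⟨σ, hσ⟩ := Equiv.Perm.exists_extending_pair [a, b, c, d].get [a', b', c', d'].get
    (List.nodup_iff_injective_get.1 h) (List.nodup_iff_injective_get.1 h')
  exact ⟨σ, hσ 0, hσ 1, hσ 2, hσ 3⟩

theorem sum_mul_sub_sum_swap_mul [Fintype Y] [DecidableEq Y] (x y : Y → ℤ) {v w : Y} (hvw : v ≠ w) :
    ∑ u, x u * y u - ∑ u, x (Equiv.swap v w u) * y u = (x v - x w) * (y v - y w) := by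
  rw [← Finset.sum_sub_distrib, Fintype.sum_eq_add v w hvw]
  · rw [Equiv.swap_apply_left, Equiv.swap_apply_right]
    ring
  · rintro u ⟨h1, h2⟩
    rw [Equiv.swap_apply_of_ne_of_ne h1 h2, sub_self]

/-- The effect of a transposition on the overlap of two symmetric matrices with zero diagonal. -/
theorem sum_sum_mul_sub_swap [Fintype Y] [DecidableEq Y] {φ ψ : Y → Y → ℤ}
    (hφ : ∀ u v, φ u v = φ v u) (hφ0 : ∀ u, φ u u = 0) (hψ : ∀ u v, ψ u v = ψ v u)
    {p q : Y} (hpq : p ≠ q) :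
    ∑ u, ∑ v, φ u v * ψ u v - ∑ u, ∑ v, φ (Equiv.swap p q u) (Equiv.swap p q v) * ψ u v =
      2 * ∑ v, (φ p v - φ q v) * (if v = p ∨ v = q then 0 else ψ p v - ψ q v) := by
  have h2 : ∀ f : Y → ℤ, ∑ v, f v = f p + f q + ∑ v, if v = p ∨ v = q then 0 else f v := by
    intro f
    have : ∀ v, f v = (if v = p ∨ v = q then f v else 0) + if v = p ∨ v = q then 0 else f v := by
      intro v; split_ifs <;> simp
    rw [Finset.sum_congr rfl fun v _ => this v, Finset.sum_add_distrib]
    congr 1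
    rw [Fintype.sum_eq_add p q hpq]
    · simp
    · rintro u ⟨h1, h2⟩
      simp [h1, h2]
  have hout : ∀ u, ¬ (u = p ∨ u = q) →
      ∑ v, φ u v * ψ u v - ∑ v, φ (Equiv.swap p q u) (Equiv.swap p q v) * ψ u v =
        (φ p u - φ q u) * (ψ p u - ψ q u) := by
    intro u hu
    push Not at hu
    rw [Equiv.swap_apply_of_ne_of_ne hu.1 hu.2, sum_mul_sub_sum_swap_mul (φ u) (ψ u) hpq,
      hφ u, hφ u, hψ u, hψ u]
  have hp : ∑ v, φ p v * ψ p v - ∑ v, φ (Equiv.swap p q p) (Equiv.swap p q v) * ψ p v =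
      ∑ v, if v = p ∨ v = q then 0 else (φ p v - φ q v) * ψ p v := by
    rw [Equiv.swap_apply_left, ← Finset.sum_sub_distrib, h2]
    rw [Equiv.swap_apply_left, Equiv.swap_apply_right, hφ0, hφ0, hφ q p]
    simp only [sub_self, zero_mul, zero_add]
    refine Finset.sum_congr rfl fun v _ => ?_
    split_ifs with hv
    · rfl
    · push Not at hv
      rw [Equiv.swap_apply_of_ne_of_ne hv.1 hv.2]
      ring
  have hq : ∑ v, φ q v * ψ q v - ∑ v, φ (Equiv.swap p q q) (Equiv.swap p q v) * ψ q v =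
      ∑ v, if v = p ∨ v = q then 0 else (φ q v - φ p v) * ψ q v := by
    rw [Equiv.swap_apply_right, ← Finset.sum_sub_distrib, h2]
    rw [Equiv.swap_apply_left, Equiv.swap_apply_right, hφ0, hφ0, hφ q p]
    simp only [sub_self, zero_mul, zero_add]
    refine Finset.sum_congr rfl fun v _ => ?_
    split_ifs with hv
    · rfl
    · push Not at hv
      rw [Equiv.swap_apply_of_ne_of_ne hv.1 hv.2]
      ring
  rw [← Finset.sum_sub_distrib, h2, hp, hq, Finset.mul_sum, ← Finset.sum_add_distrib,
    ← Finset.sum_add_distrib]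
  refine Finset.sum_congr rfl fun v _ => ?_
  split_ifs with hv
  · ring
  · rw [hout v hv]
    ring

/-- A regular graph in which the difference of two rows of the adjacency matrix is constant outside
the two vertices is complete or empty. -/
theorem SimpleGraph.eq_bot_or_eq_top_of_rows [Finite Y] (Φ : SimpleGraph Y) [DecidableRel Φ.Adj]
    (hreg : ∀ y y', (Φ.neighborSet y).ncard = (Φ.neighborSet y').ncard)
    (hrow : ∀ p q v w, [p, q, v, w].Nodup → Φ.adjMatrix ℤ p v - Φ.adjMatrix ℤ q v =
      Φ.adjMatrix ℤ p w - Φ.adjMatrix ℤ q w) :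
    Φ = ⊥ ∨ Φ = ⊤ := by
  classical
  have := Fintype.ofFinite Y
  set φ := Φ.adjMatrix ℤ with hφdef
  have hφ : ∀ u v, (Φ.Adj u v → φ u v = 1) ∧ (¬ Φ.Adj u v → φ u v = 0) := fun u v =>
    ⟨fun h => by simp [hφdef, h], fun h => by simp [hφdef, h]⟩
  have hsum : ∀ y, ∑ v, φ y v = (Φ.neighborSet y).ncard := by
    intro y
    simp only [hφdef, SimpleGraph.adjMatrix_apply, Finset.sum_boole, Set.ncard_eq_toFinset_card']
    congr 2
    ext; simp
  have hzero : ∀ p q v, p ≠ q → v ≠ p → v ≠ q → φ p v = φ q v := by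
    intro p q v hpq hvp hvq
    have h0 : ∑ u, (φ p u - φ q u) = 0 := by
      rw [Finset.sum_sub_distrib, hsum, hsum, hreg p q, sub_self]
    have h1 : ∀ u, φ p u - φ q u = (if u = p ∨ u = q then φ p u - φ q u else 0) +
        (if u = p ∨ u = q then 0 else φ p v - φ q v) := by
      intro u
      split_ifs with hu
      · simp
      · push Not at hu
        rcases eq_or_ne u v with rfl | huv
        · simp
        · rw [zero_add]
          refine hrow p q u v ?_
          simp [hpq, hu.1.symm, hu.2.symm, hvp.symm, hvq.symm, huv]
    rw [Finset.sum_congr rfl fun u _ => h1 u, Finset.sum_add_distrib, Fintype.sum_eq_add p q hpq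
      (by rintro u ⟨h1, h2⟩; simp [h1, h2])] at h0
    have hd : ∀ u, φ u u = 0 := fun u => (hφ u u).2 (Φ.loopless.irrefl u)
    have hs : φ p q = φ q p := by
      by_cases ha : Φ.Adj p q
      · rw [(hφ _ _).1 ha, (hφ _ _).1 ha.symm]
      · rw [(hφ _ _).2 ha, (hφ _ _).2 fun e => ha e.symm]
    simp only [true_or, or_true, if_true, hd, hs, zero_sub, sub_zero, neg_add_cancel,
      zero_add] at h0
    rw [Finset.sum_ite, Finset.sum_const_zero, zero_add, Finset.sum_const, nsmul_eq_mul,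
      mul_eq_zero] at h0
    rcases h0 with h0 | h0
    · have : v ∈ Finset.univ.filter fun u => ¬ (u = p ∨ u = q) := by simp [hvp, hvq]
      rw [Nat.cast_eq_zero, Finset.card_eq_zero] at h0
      rw [h0] at this
      exact absurd this (Finset.notMem_empty _)
    · linarith
  have hadj : ∀ p q v, v ≠ q → Φ.Adj p v → Φ.Adj q v := by
    intro p q v hvq hpv
    rcases eq_or_ne p q with rfl | hpq
    · exact hpv
    · by_contra hqv
      have := hzero p q v hpq hpv.ne' hvq
      rw [(hφ _ _).1 hpv, (hφ _ _).2 hqv] at this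
      exact one_ne_zero this
  by_cases hbot : Φ = ⊥
  · exact Or.inl hbot
  · right
    obtain ⟨u, v, huv⟩ := SimpleGraph.ne_bot_iff_exists_adj.1 hbot
    rw [eq_top_iff]
    intro w w' hww
    rw [SimpleGraph.top_adj] at hww
    rcases eq_or_ne w' v with rfl | hw'
    · exact hadj u w w' hww.symm huv
    · exact hadj v w w' hww.symm (hadj u w' v hw'.symm huv).symm

/-- The overlap of `Φ`, moved by `σ`, and `Ψ` is an isomorphism invariant of the pair of graphs. If
both graphs are regular but neither is empty or complete, it depends on `σ`. -/
theorem SimpleGraph.homogeneous_of_forall_overlay [Finite Y] (Φ Ψ : SimpleGraph Y)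
    (hΦ : ∀ y y', (Φ.neighborSet y).ncard = (Φ.neighborSet y').ncard)
    (hΨ : ∀ y y', (Ψ.neighborSet y).ncard = (Ψ.neighborSet y').ncard)
    (hiso : ∀ σ : Equiv.Perm Y, ∃ f : Equiv.Perm Y,
      (∀ y y', Φ.Adj (σ (f y)) (σ (f y')) ↔ Φ.Adj y y') ∧
      (∀ y y', Ψ.Adj (f y) (f y') ↔ Ψ.Adj y y')) :
    (Φ = ⊥ ∨ Φ = ⊤) ∨ (Ψ = ⊥ ∨ Ψ = ⊤) := by
  classical
  have := Fintype.ofFinite Y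
  set φ := Φ.adjMatrix ℤ with hφdef
  set ψ := Ψ.adjMatrix ℤ with hψdef
  have hφs : ∀ u v, φ u v = φ v u := fun u v => by simp [hφdef, Φ.adj_comm]
  have hψs : ∀ u v, ψ u v = ψ v u := fun u v => by simp [hψdef, Ψ.adj_comm]
  have hφ0 : ∀ u, φ u u = 0 := fun u => by simp [hφdef]
  let F : Equiv.Perm Y → ℤ := fun σ => ∑ u, ∑ v, φ (σ u) (σ v) * ψ u v
  have hF : ∀ σ, F σ = F 1 := by
    intro σ
    obtain ⟨f, hf, hf'⟩ := hiso σ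
    have h1 : ∀ u v, φ (σ (f u)) (σ (f v)) = φ u v := fun u v => by
      simp only [hφdef, SimpleGraph.adjMatrix_apply, hf]
    have h2 : ∀ u v, ψ (f u) (f v) = ψ u v := fun u v => by
      simp only [hψdef, SimpleGraph.adjMatrix_apply, hf']
    calc F σ = ∑ u, ∑ v, φ (σ (f u)) (σ v) * ψ (f u) v :=
          (Equiv.sum_comp f fun u => ∑ v, φ (σ u) (σ v) * ψ u v).symm
      _ = ∑ u, ∑ v, φ (σ (f u)) (σ (f v)) * ψ (f u) (f v) := Finset.sum_congr rfl fun u _ =>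
          (Equiv.sum_comp f fun v => φ (σ (f u)) (σ v) * ψ (f u) v).symm
      _ = F 1 := by simp only [h1, h2]; rfl
  have h1 : ∀ (σ : Equiv.Perm Y) (p q : Y), p ≠ q →
      ∑ v, (φ (σ p) (σ v) - φ (σ q) (σ v)) * (if v = p ∨ v = q then 0 else ψ p v - ψ q v) = 0 := by
    intro σ p q hpq
    have h2 := sum_sum_mul_sub_swap (φ := fun u v => φ (σ u) (σ v)) (ψ := ψ) (fun u v => hφs _ _)
      (fun u => hφ0 _) hψs hpq
    have h3 : F σ - F (σ * Equiv.swap p q) = 0 := by rw [hF, hF (σ * _), sub_self]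
    have h4 := h2.symm.trans h3
    simpa using h4
  have h2 : ∀ (σ : Equiv.Perm Y) (p q v w : Y), [p, q, v, w].Nodup →
      ((φ (σ p) (σ v) - φ (σ q) (σ v)) - (φ (σ p) (σ w) - φ (σ q) (σ w))) *
        ((ψ p v - ψ q v) - (ψ p w - ψ q w)) = 0 := by
    intro σ p q v w hd
    simp only [List.nodup_cons, List.mem_cons, List.not_mem_nil, or_false, not_or,
      not_false_eq_true, List.nodup_nil, and_true] at hd
    obtain ⟨⟨hpq, hpv, hpw⟩, ⟨hqv, hqw⟩, hvw⟩ := hd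
    have h3 := sum_mul_sub_sum_swap_mul (fun u => φ (σ p) (σ u) - φ (σ q) (σ u))
      (fun u => if u = p ∨ u = q then 0 else ψ p u - ψ q u) hvw
    have h4 := h1 (σ * Equiv.swap v w) p q hpq
    simp only [Equiv.Perm.mul_apply, Equiv.swap_apply_of_ne_of_ne hpv hpw,
      Equiv.swap_apply_of_ne_of_ne hqv hqw] at h4
    rw [h1 σ p q hpq, h4] at h3
    simpa [Ne.symm hpv, Ne.symm hqv, Ne.symm hpw, Ne.symm hqw] using h3.symm
  by_contra! hcon
  obtain ⟨⟨hΦ1, hΦ2⟩, hΨ1, hΨ2⟩ := hcon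
  have hφ' := mt (Φ.eq_bot_or_eq_top_of_rows hΦ) (by simp [hΦ1, hΦ2])
  have hψ' := mt (Ψ.eq_bot_or_eq_top_of_rows hΨ) (by simp [hΨ1, hΨ2])
  push Not at hφ' hψ'
  obtain ⟨p', q', v', w', hd', hne'⟩ := hφ'
  obtain ⟨p, q, v, w, hd, hne⟩ := hψ'
  obtain ⟨σ, rfl, rfl, rfl, rfl⟩ := exists_perm_four hd hd'
  rcases mul_eq_zero.1 (h2 σ p q v w hd) with h3 | h3
  · exact hne' (sub_eq_zero.1 h3)
  · exact hne (sub_eq_zero.1 h3)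

/-- For two maps onto a set with at least two elements, the number of points where they agree
changes if the first map is composed with suitable permutations. -/
theorem exists_card_agree_ne [Finite Y] {Z : Type*} [Nontrivial Z] {F F' : Y → Z}
    (hF : F.Surjective) (hF' : F'.Surjective) :
    ∃ σ : Equiv.Perm Y, {y | F (σ y) = F' y}.ncard ≠ {y | F y = F' y}.ncard := by
  classical
  by_contra! hcon
  obtain ⟨a, b, hab⟩ := exists_pair_ne Z
  obtain ⟨x, rfl⟩ := hF a
  obtain ⟨y, rfl⟩ := hF b
  obtain ⟨x', hx'⟩ := hF' (F x)
  obtain ⟨y', hy'⟩ := hF' (F y)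
  have hxy : x ≠ y := fun e => hab (congrArg F e)
  have hxy' : x' ≠ y' := fun e => hab (by rw [← hx', ← hy', e])
  obtain ⟨σ, hσ⟩ := Equiv.Perm.exists_extending_pair [x', y'].get [x, y].get
    (List.nodup_iff_injective_get.1 (by simpa using hxy'))
    (List.nodup_iff_injective_get.1 (by simpa using hxy))
  have hσx : σ x' = x := hσ 0
  have hσy : σ y' = y := hσ 1
  have hlt : {z | F ((σ * Equiv.swap x' y') z) = F' z}.ncard < {z | F (σ z) = F' z}.ncard := by
    refine Set.ncard_lt_ncard (Set.ssubset_iff_exists.2 ⟨?_, x', ?_, ?_⟩) (Set.toFinite _)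
    · intro z hz
      simp only [Set.mem_ofPred_eq, Equiv.Perm.mul_apply] at hz ⊢
      by_cases h1 : z = x'
      · rw [h1, hσx, hx']
      by_cases h2 : z = y'
      · rw [h2, hσy, hy']
      rwa [Equiv.swap_apply_of_ne_of_ne h1 h2] at hz
    · simp [hσx, hx']
    · simp [hσy, hx', hab.symm]
  rw [hcon, hcon] at hlt
  exact lt_irrefl _ hlt

end Overlay

/-! ### Rewiring the edges between two cells -/

section Rewire

variable {V K : Type*} {G : SimpleGraph V} {c : V → K}

/-- The edges between two cells may be replaced by those of any other bipartite graph with the same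
degrees; the resulting graph is isomorphic to the original one. -/
theorem UniqueRealization.exists_perm_of_rewire (hU : UniqueRealization G c) {d e : K} (hde : d ≠ e)
    (R : V → V → Prop)
    (h1 : ∀ u, c u = d → {v | R u v ∧ c v = e}.ncard = cellDegree G c u e)
    (h2 : ∀ v, c v = e → {u | R u v ∧ c u = d}.ncard = cellDegree G c v d) :
    ∃ f : Equiv.Perm V, (∀ v, c (f v) = c v) ∧
      (∀ u v, c u = d → c v = e → (R (f u) (f v) ↔ G.Adj u v)) ∧
      (∀ u v, ¬ (c u = d ∧ c v = e) → ¬ (c u = e ∧ c v = d) →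
        (G.Adj (f u) (f v) ↔ G.Adj u v)) := by
  let G' : SimpleGraph V :=
    { Adj := fun u v => (c u = d ∧ c v = e ∧ R u v) ∨ (c u = e ∧ c v = d ∧ R v u) ∨
        (¬ (c u = d ∧ c v = e) ∧ ¬ (c u = e ∧ c v = d) ∧ G.Adj u v)
      symm := ⟨by
        rintro u v (⟨hu, hv, hR⟩ | ⟨hu, hv, hR⟩ | ⟨hu, hv, hR⟩)
        · exact Or.inr (Or.inl ⟨hv, hu, hR⟩)
        · exact Or.inl ⟨hv, hu, hR⟩
        · exact Or.inr (Or.inr ⟨fun h => hv ⟨h.2, h.1⟩, fun h => hu ⟨h.2, h.1⟩, hR.symm⟩)⟩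
      loopless := ⟨by
        rintro u (⟨hu, hv, -⟩ | ⟨hu, hv, -⟩ | ⟨-, -, hR⟩)
        · exact hde (hu.symm.trans hv)
        · exact hde (hv.symm.trans hu)
        · exact G.loopless.irrefl u hR⟩ }
  have hcross : ∀ u v, c u = d → c v = e → (G'.Adj u v ↔ R u v) := by
    intro u v hu hv
    have h3 : c u ≠ e := fun h => hde (hu.symm.trans h)
    simp only [G', hu, hv, true_and, not_true_eq_false, false_and, or_false, hde]
  have hother : ∀ u v, ¬ (c u = d ∧ c v = e) → ¬ (c u = e ∧ c v = d) →
      (G'.Adj u v ↔ G.Adj u v) := by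
    intro u v h3 h4
    simp only [G', ← and_assoc, h3, h4, not_false_eq_true, true_and, false_and, false_or]
  obtain ⟨f, hf⟩ := hU.unique G' (by
    intro v k
    by_cases hvd : c v = d
    · by_cases hk : k = e
      · subst hk
        rw [← h1 v hvd, cellDegree]
        congr 1
        ext w
        exact and_congr_left fun hw => hcross v w hvd hw
      · refine congrArg Set.ncard (Set.ext fun w => and_congr_left fun hw => hother v w ?_ ?_)
        · exact fun h => hk (hw.symm.trans h.2)
        · exact fun h => hde (hvd.symm.trans h.1)
    by_cases hve : c v = e
    · by_cases hk : k = d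
      · subst hk
        rw [← h2 v hve, cellDegree]
        congr 1
        ext w
        exact and_congr_left fun hw => by rw [G'.adj_comm]; exact hcross w v hw hve
      · refine congrArg Set.ncard (Set.ext fun w => and_congr_left fun hw => hother v w ?_ ?_)
        · exact fun h => hde (h.1.symm.trans hve)
        · exact fun h => hk (hw.symm.trans h.2)
    · exact congrArg Set.ncard (Set.ext fun w => and_congr_left fun hw =>
        hother v w (fun h => hvd h.1) (fun h => hve h.1)))
  refine ⟨f.toEquiv, hf, fun u v hu hv => ?_, fun u v hu hv => ?_⟩
  · exact (hcross _ _ ((hf u).trans hu) ((hf v).trans hv)).symm.trans f.map_adj_iff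
  · rw [← hother _ _ (by rwa [RelIso.coe_fn_toEquiv, hf, hf])
      (by rwa [RelIso.coe_fn_toEquiv, hf, hf])]
    exact f.map_adj_iff

/-- Rewiring by a permutation of one of the two cells. -/
theorem UniqueRealization.exists_perm_of_twist (hU : UniqueRealization G c) {d e : K} (hde : d ≠ e)
    (σ : Equiv.Perm V) (hσ : ∀ v, c (σ v) = c v) :
    ∃ f : Equiv.Perm V, (∀ v, c (f v) = c v) ∧
      (∀ u v, c u = d → c v = e → (G.Adj (f u) (σ (f v)) ↔ G.Adj u v)) ∧
      (∀ u v, ¬ (c u = d ∧ c v = e) → ¬ (c u = e ∧ c v = d) →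
        (G.Adj (f u) (f v) ↔ G.Adj u v)) := by
  refine hU.exists_perm_of_rewire hde (fun u v => G.Adj u (σ v)) (fun u _ => ?_) (fun v _ => ?_)
  · exact card_subtype_congr σ fun v => by
      simp only [Set.mem_ofPred_eq, hσ]
  · rw [← hU.equitable (σ v) v (hσ v)]
    simp only [G.adj_comm, cellDegree]

/-- `F` maps the cell of colour `e` to the cell of colour `r`, with fibres of equal size. -/
structure IsEquitableMap (c : V → K) (e r : K) (F : V → V) : Prop where
  maps : ∀ y, c y = e → c (F y) = r
  fibre : ∀ x x', c x = r → c x' = r →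
    {y | c y = e ∧ F y = x}.ncard = {y | c y = e ∧ F y = x'}.ncard

/-- Twisting the stars between two cells by a permutation of the leaves. -/
theorem UniqueRealization.exists_perm_of_twist_star (hU : UniqueRealization G c) {d e : K}
    (hde : d ≠ e) {p : V → V} {ε : Prop} (hp : IsEquitableMap c e d p)
    (hε : ∀ x y, c x = d → c y = e → (G.Adj x y ↔ (ε ↔ x = p y)))
    (σ : Equiv.Perm {v // c v = e}) :
    ∃ f : Equiv.Perm V, ∃ hf : ∀ v, c (f v) = c v,
      (∀ y (hy : c y = e), p (σ ⟨f y, (hf y).trans hy⟩) = f (p y)) ∧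
      (∀ u v, ¬ (c u = d ∧ c v = e) → ¬ (c u = e ∧ c v = d) →
        (G.Adj (f u) (f v) ↔ G.Adj u v)) := by
  classical
  have hτ : ∀ v (hv : c v = e), Equiv.Perm.ofSubtype σ v = σ ⟨v, hv⟩ := fun v hv =>
    Equiv.Perm.ofSubtype_apply_of_mem σ hv
  obtain ⟨f, hf, hfp, hfo⟩ := hU.exists_perm_of_twist hde (Equiv.Perm.ofSubtype σ) (by
    intro v
    by_cases hv : c v = e
    · rw [hτ v hv, (σ _).2, hv]
    · rw [Equiv.Perm.ofSubtype_apply_of_not_mem σ hv])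
  refine ⟨f, hf, fun y hy => ?_, hfo⟩
  have h1 := hfp (p y) y (hp.maps y hy) hy
  rw [hτ (f y) ((hf y).trans hy), hε _ _ ((hf _).trans (hp.maps y hy)) (σ _).2,
    hε _ _ (hp.maps y hy) hy] at h1
  by_contra hne
  have hne' := Ne.symm hne
  simp only [ne_eq] at hne'
  simp [hne'] at h1

variable [Finite V]

theorem IsEquitableMap.exists_eq {e r : K} {F : V → V} (hF : IsEquitableMap c e r F) {y : V}
    (hy : c y = e) {x : V} (hx : c x = r) : ∃ y', c y' = e ∧ F y' = x := by
  have h1 : {y' | c y' = e ∧ F y' = F y}.ncard ≠ 0 :=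
    Set.ncard_ne_zero_of_mem (a := y) ⟨hy, rfl⟩
  rw [hF.fibre _ x (hF.maps y hy) hx] at h1
  exact Set.nonempty_of_ncard_ne_zero h1

theorem IsEquitableMap.comp {e d r : K} {F F' : V → V} (hF : IsEquitableMap c e d F)
    (hF' : IsEquitableMap c d r F') : IsEquitableMap c e r (F' ∘ F) where
  maps y hy := hF'.maps _ (hF.maps y hy)
  fibre := by
    classical
    have := Fintype.ofFinite V
    by_cases hd : ∃ z, c z = d
    · obtain ⟨z, hz⟩ := hd
      have key : ∀ x, {y | c y = e ∧ (F' ∘ F) y = x}.ncard =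
          {y | c y = d ∧ F' y = x}.ncard * {y | c y = e ∧ F y = z}.ncard := by
        intro x
        rw [Set.ncard_eq_toFinset_card' {y | c y = e ∧ (F' ∘ F) y = x},
          Finset.card_eq_sum_card_fiberwise (f := F) (t := {y | c y = d ∧ F' y = x}.toFinset),
          Set.ncard_eq_toFinset_card' {y | c y = d ∧ F' y = x}, ← smul_eq_mul, ← Finset.sum_const]
        · refine Finset.sum_congr rfl fun w hw => ?_
          simp only [Set.mem_toFinset, Set.mem_ofPred_eq] at hw
          rw [hF.fibre z w hz hw.1, Set.ncard_eq_toFinset_card']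
          congr 1
          ext y
          simp only [Finset.mem_filter, Set.mem_toFinset, Set.mem_ofPred_eq, Function.comp_apply]
          exact ⟨fun h => ⟨h.1.1, h.2⟩, fun h => ⟨⟨h.1, h.2 ▸ hw.2⟩, h.2⟩⟩
        · intro y hy
          simp only [Set.coe_toFinset, Set.mem_ofPred_eq, Function.comp_apply] at hy ⊢
          exact ⟨hF.maps y hy.1, hy.2⟩
      intro x x' hx hx'
      rw [key, key, hF'.fibre x x' hx hx']
    · intro x x' _ _
      have : ∀ y, c y ≠ e := fun y hy => hd ⟨_, hF.maps y hy⟩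
      simp [this]

/-- If the edges between the cells `d` and `e` are neither none nor all possible ones and `d` is not
larger than `e`, then they form a disjoint union of stars with centres in `d`, up to
complementation (expressed by `ε`); `p` maps the leaves to the centres. -/
theorem UniqueRealization.exists_star_map (hU : UniqueRealization G c) {d e : K} (hde : d ≠ e)
    (hadj : ∃ u, c u = d ∧ ∃ v, c v = e ∧ G.Adj u v)
    (hnadj : ∃ u, c u = d ∧ ∃ v, c v = e ∧ ¬ G.Adj u v)
    (hle : {v | c v = d}.ncard ≤ {v | c v = e}.ncard) :
    ∃ (p : V → V) (ε : Prop), IsEquitableMap c e d p ∧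
      ∀ x y, c x = d → c y = e → (G.Adj x y ↔ (ε ↔ x = p y)) := by
  classical
  obtain ⟨u, hu, v, hv, huv⟩ := hadj
  obtain ⟨u', hu', v', hv', huv'⟩ := hnadj
  let R : {x // c x = d} → {y // c y = e} → Prop := fun x y => G.Adj x y
  have hcard : ∀ {k : K} (q : {x // c x = k} → Prop),
      Nat.card {x // q x} = {x | ∃ hx : c x = k, q ⟨x, hx⟩}.ncard := fun {k} q =>
    Nat.card_congr (Equiv.subtypeSubtypeEquivSubtypeExists _ q)
  have hR : UniqueBiregular R (cellDegree G c u e) (cellDegree G c v d) := by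
    refine ⟨⟨fun x => ?_, fun y => ?_⟩, fun R' hR' => ?_⟩
    · rw [hcard, hU.equitable u x (hu.trans x.2.symm), cellDegree]
      simp [R, and_comm]
    · rw [hcard, hU.equitable v y (hv.trans y.2.symm), cellDegree]
      simp [R, and_comm, G.adj_comm]
    · obtain ⟨f, hf, hfR, -⟩ := hU.exists_perm_of_rewire hde
        (fun x y => ∃ (hx : c x = d) (hy : c y = e), R' ⟨x, hx⟩ ⟨y, hy⟩)
        (fun x hx => by
          rw [hU.equitable x u (hx.trans hu.symm), ← hR'.left ⟨x, hx⟩, hcard]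
          congr 1
          ext y
          simp only [Set.mem_ofPred_eq]
          exact ⟨fun h => h.1.2, fun h => ⟨⟨hx, h⟩, h.1⟩⟩)
        (fun y hy => by
          rw [hU.equitable y v (hy.trans hv.symm), ← hR'.right ⟨y, hy⟩, hcard]
          congr 1
          ext x
          simp only [Set.mem_ofPred_eq]
          exact ⟨fun h => ⟨h.2, h.1.2.2⟩, fun h => ⟨⟨h.1, hy, h.2⟩, h.1⟩⟩)
      refine ⟨f.subtypePerm fun x => by rw [hf], f.subtypePerm fun x => by rw [hf], fun x y => ?_⟩
      refine Iff.trans ?_ (hfR x y x.2 y.2)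
      exact ⟨fun h => ⟨_, _, h⟩, fun h => h.2.2⟩
  have hb0 : 0 < cellDegree G c v d := (Set.ncard_pos (Set.toFinite _)).2 ⟨u, huv.symm, hu⟩
  have hb1 : cellDegree G c v d < Nat.card {x // c x = d} := by
    rw [hU.equitable v v' (hv.trans hv'.symm)]
    exact Set.ncard_lt_ncard (Set.ssubset_iff_exists.2
      ⟨fun x hx => hx.2, u', hu', fun h => huv' h.1.symm⟩) (Set.toFinite _)
  have hcases := hR.degree_cases (Set.ncard_pos (Set.toFinite _) |>.2 ⟨v, hv⟩) hle hb0 hb1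
  obtain ⟨ε, R₁, a, hR₁, hε⟩ : ∃ (ε : Prop) (R₁ : {x // c x = d} → {y // c y = e} → Prop) (a : ℕ),
      Biregular R₁ a 1 ∧ ∀ x y, G.Adj x.1 y.1 ↔ (ε ↔ R₁ x y) := by
    rcases hcases with h1 | h1
    · exact ⟨True, R, _, h1 ▸ hR.1, fun x y => by simp [R]⟩
    · refine ⟨False, fun x y => ¬ R x y, Nat.card {y // c y = e} - cellDegree G c u e, ?_,
        fun x y => by simp [R]⟩
      have h2 := hR.1.compl
      rwa [show Nat.card {x // c x = d} - cellDegree G c v d = 1 by omega] at h2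
  have hex : ∀ y : {y // c y = e}, ∃ x, ∀ x', R₁ x' y ↔ x' = x := by
    intro y
    obtain ⟨x, hx⟩ := Nat.card_eq_one_iff_exists.1 (hR₁.right y)
    exact ⟨x.1, fun x' => ⟨fun h => congrArg Subtype.val (hx ⟨x', h⟩), fun h => h ▸ x.2⟩⟩
  choose q hq using hex
  let p : V → V := fun y => if hy : c y = e then q ⟨y, hy⟩ else y
  have hp : ∀ y (hy : c y = e), p y = q ⟨y, hy⟩ := fun y hy => by simp [p, hy]
  refine ⟨p, ε, ⟨fun y hy => by rw [hp y hy]; exact (q _).2, ?_⟩, fun x y hx hy => ?_⟩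
  · have h3 : ∀ x, c x = d → {y | c y = e ∧ p y = x}.ncard = a := by
      intro x hx
      rw [← hR₁.left ⟨x, hx⟩, hcard]
      congr 1
      ext y
      simp only [Set.mem_ofPred_eq, hq]
      refine ⟨fun h => ⟨h.1, Subtype.ext (h.2.symm.trans (hp y h.1))⟩, fun h => ⟨h.1, ?_⟩⟩
      rw [hp y h.1, ← h.2]
    intro x x' hx hx'
    rw [h3 x hx, h3 x' hx']
  · rw [hε ⟨x, hx⟩ ⟨y, hy⟩, hq, hp y hy, Subtype.ext_iff]

end Rewire

/-! ### The order in which the cells are processed -/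

section Fibres

variable {V K : Type*} {G : SimpleGraph V}

theorem exists_adj_of_reachable {T : SimpleGraph K} {a b z : K} (hab : T.Reachable a b)
    (hbz : T.Adj b z) : ∃ w, T.Adj a w := by
  obtain ⟨p⟩ := hab
  cases p with
  | nil => exact ⟨z, hbz⟩
  | cons hadj _ => exact ⟨_, hadj⟩

/-- The graph on the cell `e` in which two vertices are adjacent if `F` maps them to the same
vertex. -/
def fibreGraph (c : V → K) (e : K) (F : V → V) :
    SimpleGraph {v // c v = e} where
  Adj y y' := y ≠ y' ∧ F y = F y'
  symm := ⟨fun _ _ hy => ⟨hy.1.symm, hy.2.symm⟩⟩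
  loopless := ⟨fun _ hy => hy.1 rfl⟩

theorem IsEquitableMap.fibreGraph_regular {c : V → K} {e r : K} {F : V → V}
    (hF : IsEquitableMap c e r F) (y y' : {v // c v = e}) :
    ((fibreGraph c e F).neighborSet y).ncard = ((fibreGraph c e F).neighborSet y').ncard := by
  have key : ∀ y : {v // c v = e}, ((fibreGraph c e F).neighborSet y).ncard =
      {z | c z = e ∧ F z = F y}.ncard - 1 := by
    intro y
    rw [← Set.ncard_sdiff_singleton_of_mem (a := y.1) (s := {z | c z = e ∧ F z = F y}) ⟨y.2, rfl⟩,
      ← Set.ncard_image_of_injective _ Subtype.val_injective]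
    congr 1
    ext z
    simp only [Set.mem_image, SimpleGraph.mem_neighborSet, Set.mem_sdiff, Set.mem_ofPred_eq,
      Set.mem_singleton_iff]
    constructor
    · rintro ⟨z, ⟨hne, hz⟩, rfl⟩
      exact ⟨⟨z.2, hz.symm⟩, fun e => hne (Subtype.ext e.symm)⟩
    · rintro ⟨⟨hz, hFz⟩, hne⟩
      exact ⟨⟨z, hz⟩, ⟨fun e => hne (congrArg Subtype.val e).symm, hFz.symm⟩, rfl⟩
  rw [key, key, hF.fibre _ _ (hF.maps y y.2) (hF.maps y' y'.2)]

/-- The graph induced by a cell is regular. -/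
theorem UniqueRealization.induce_regular {c : V → K} (hU : UniqueRealization G c) (e : K)
    (y y' : {v // c v = e}) :
    (((G.comap Subtype.val : SimpleGraph {v // c v = e})).neighborSet y).ncard =
      ((G.comap Subtype.val : SimpleGraph {v // c v = e}).neighborSet y').ncard := by
  have key : ∀ y : {v // c v = e},
      ((G.comap Subtype.val : SimpleGraph {v // c v = e}).neighborSet y).ncard =
        cellDegree G c y e := by
    intro y
    rw [cellDegree, ← Set.ncard_image_of_injective _ Subtype.val_injective]
    congr 1
    ext z
    simp [SimpleGraph.mem_neighborSet, and_comm]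
  rw [key, key, hU.equitable y y' (y.2.trans y'.2.symm)]

theorem IsEquitableMap.fibreGraph_ne [Finite V] {c : V → K} {e r : K} {F : V → V}
    (hF : IsEquitableMap c e r F) (hr : 2 ≤ {v | c v = r}.ncard)
    (hlt : {v | c v = r}.ncard < {v | c v = e}.ncard) :
    ¬ (fibreGraph c e F = ⊥ ∨ fibreGraph c e F = ⊤) := by
  obtain ⟨y, hy, y', hy', hne, hFy⟩ := Set.exists_ne_map_eq_of_ncard_lt_of_maps_to hlt
    (f := F) (fun y hy => hF.maps y hy) (Set.toFinite _)
  rintro (hbot | htop)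
  · have : (fibreGraph c e F).Adj ⟨y, hy⟩ ⟨y', hy'⟩ :=
      ⟨fun e => hne (congrArg Subtype.val e), hFy⟩
    rw [hbot] at this
    exact this
  · obtain ⟨x, hx, x', hx', hxx⟩ := (Set.one_lt_ncard (Set.toFinite _)).1 hr
    obtain ⟨z, hz, rfl⟩ := hF.exists_eq hy hx
    obtain ⟨z', hz', rfl⟩ := hF.exists_eq hy hx'
    have : (fibreGraph c e F).Adj ⟨z, hz⟩ ⟨z', hz'⟩ := by
      rw [htop]
      exact fun e => hxx (congrArg F (congrArg Subtype.val e))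
    exact hxx this.2

theorem SimpleGraph.Iso.regular {Y Z : Type*} {Φ : SimpleGraph Y} {Ψ : SimpleGraph Z} (I : Φ ≃g Ψ)
    (hΨ : ∀ z z', (Ψ.neighborSet z).ncard = (Ψ.neighborSet z').ncard) (y y' : Y) :
    (Φ.neighborSet y).ncard = (Φ.neighborSet y').ncard :=
  (Nat.card_congr (I.mapNeighborSet y)).trans
    ((hΨ _ _).trans (Nat.card_congr (I.mapNeighborSet y')).symm)

theorem SimpleGraph.Iso.eq_bot_or_eq_top {Y Z : Type*} {Φ : SimpleGraph Y} {Ψ : SimpleGraph Z}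
    (I : Φ ≃g Ψ) (hΦ : Φ = ⊥ ∨ Φ = ⊤) : Ψ = ⊥ ∨ Ψ = ⊤ := by
  have key : ∀ z z', Ψ.Adj z z' ↔ Φ.Adj (I.symm z) (I.symm z') := fun z z' =>
    I.symm.map_adj_iff.symm
  rcases hΦ with rfl | rfl
  · left
    ext z z'
    rw [key]
    simp
  · right
    ext z z'
    rw [key]
    simp

end Fibres

section Cells

variable {V L : Type*} [Fintype V] {G : SimpleGraph V} {l : V → L} {h : ℕ}

theorem UniqueRealization.two_le_ncard_cell (hU : UniqueRealization G (wlColour G l h))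
    {d e : WLColour L h} (hde : (anisoGraph G l h).Adj d e) : 2 ≤ (cell G l h d).ncard := by
  obtain ⟨-, ⟨u, hu, v, hv, huv⟩, ⟨u', hu', v', hv', huv'⟩⟩ := hde
  by_contra! hlt
  have hsub : ∀ x ∈ cell G l h d, x = u := fun x hx =>
    (Set.ncard_le_one (Set.toFinite _)).1 (Nat.lt_succ_iff.1 hlt) x hx u hu
  have hcard := hU.equitable v v' (Eq.trans hv (Eq.symm hv')) d
  have h1 : cellDegree G (wlColour G l h) v d ≠ 0 :=
    Set.ncard_ne_zero_of_mem (a := u) ⟨huv.symm, hu⟩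
  rw [hcard] at h1
  obtain ⟨x, hx, hxd⟩ := Set.nonempty_of_ncard_ne_zero h1
  rw [hsub x hxd, ← hsub u' hu'] at hx
  exact huv' hx.symm

theorem Heterogeneous.induce_ne {e : WLColour L h} (he : Heterogeneous G l h e) :
    ¬ ((G.comap Subtype.val : SimpleGraph {v // wlColour G l h v = e}) = ⊥ ∨
      (G.comap Subtype.val : SimpleGraph {v // wlColour G l h v = e}) = ⊤) := by
  obtain ⟨⟨u, hu, v, hv, huv⟩, ⟨u', hu', v', hv', hne, huv'⟩⟩ := he
  rintro (hbot | htop)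
  · have : (G.comap Subtype.val : SimpleGraph {v // wlColour G l h v = e}).Adj
        ⟨u, hu⟩ ⟨v, hv⟩ := huv
    rw [hbot] at this
    exact this
  · have : (G.comap Subtype.val : SimpleGraph {v // wlColour G l h v = e}).Adj
        ⟨u', hu'⟩ ⟨v', hv'⟩ := by
      rw [htop]
      exact fun e => hne (congrArg Subtype.val e)
    exact huv' this

/-- The structure that the cells of the processed colours `P` have: in each anisotropic component
the processed cells are mapped equitably to the cell that was processed first, and the map `r`
that does this is determined by the graph, hence commutes with all partial automorphisms. -/
structure IsRootMap (G : SimpleGraph V) (l : V → L) (h : ℕ) (P : Set (WLColour L h)) (r : V → V) :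
    Prop where
  mem : ∀ u, wlColour G l h u ∈ P → wlColour G l h (r u) ∈ P
  root : ∀ u, wlColour G l h u ∈ P → IsComponentRoot G l h (wlColour G l h (r u))
  reachable : ∀ u, wlColour G l h u ∈ P →
    (anisoGraph G l h).Reachable (wlColour G l h u) (wlColour G l h (r u))
  root_eq : ∀ u v, wlColour G l h u ∈ P → wlColour G l h v ∈ P →
    (anisoGraph G l h).Reachable (wlColour G l h u) (wlColour G l h v) →
    wlColour G l h (r u) = wlColour G l h (r v)
  equitable : ∀ u, wlColour G l h u ∈ P →
    IsEquitableMap (wlColour G l h) (wlColour G l h u) (wlColour G l h (r u)) r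
  equivariant : ∀ f : Equiv.Perm V, (∀ v, wlColour G l h (f v) = wlColour G l h v) →
    (∀ u v, wlColour G l h u ∈ P → wlColour G l h v ∈ P → (G.Adj (f u) (f v) ↔ G.Adj u v)) →
    ∀ u, wlColour G l h u ∈ P → r (f u) = f (r u)

theorem isRootMap_of_forall_notMem {P : Set (WLColour L h)} (hP : ∀ v, wlColour G l h v ∉ P) :
    IsRootMap G l h P id := by
  constructor <;> intros <;> exact absurd ‹wlColour G l h _ ∈ P› (hP _)

variable {P : Set (WLColour L h)} {r : V → V} {c₀ d : WLColour L h}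

/-- A cell joined to a processed cell is not smaller than it: otherwise, the partition of the
processed cell by the first cell of the component and its partition by the new cell could be
overlaid in different ways. -/
theorem IsRootMap.ncard_cell_le (hr : IsRootMap G l h P r)
    (hU : UniqueRealization G (wlColour G l h)) (hc₀ : c₀ ∉ P) (hd : d ∈ P)
    (hadj : (anisoGraph G l h).Adj d c₀) : (cell G l h d).ncard ≤ (cell G l h c₀).ncard := by
  by_contra! hlt
  obtain ⟨y, hy, -⟩ := hadj.2.1
  have hyP : wlColour G l h y ∈ P := (show wlColour G l h y = d from hy) ▸ hd
  obtain ⟨p, ε, hp, hε⟩ := hU.exists_star_map hadj.ne' hadj.symm.2.1 hadj.symm.2.2 hlt.le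
  have hrd : (anisoGraph G l h).Reachable d (wlColour G l h (r y)) := by
    have := hr.reachable y hyP
    rwa [show wlColour G l h y = d from hy] at this
  have hroot := (hr.root y hyP).1 c₀ (hrd.symm.trans hadj.reachable)
  obtain ⟨w, hw⟩ := exists_adj_of_reachable hrd.symm hadj
  have hre := hr.equitable y hyP
  rw [show wlColour G l h y = d from hy] at hre
  rcases SimpleGraph.homogeneous_of_forall_overlay (fibreGraph (wlColour G l h) d p)
    (fibreGraph (wlColour G l h) d r) hp.fibreGraph_regular hre.fibreGraph_regular (by
      intro σ
      obtain ⟨f, hf, hfp, hfo⟩ := hU.exists_perm_of_twist_star hadj.ne' hp hε σ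
      have hfr : ∀ u, wlColour G l h u = d → r (f u) = f (r u) := by
        intro u hu
        refine hr.equivariant f hf (fun a b ha hb => hfo a b ?_ ?_) u (hu ▸ hd)
        · exact fun e => hc₀ (e.1 ▸ ha)
        · exact fun e => hc₀ (e.2 ▸ hb)
      refine ⟨f.subtypePerm fun x => by rw [hf], fun y y' => ?_, fun y y' => ?_⟩
      · refine and_congr (not_congr ?_) ?_
        · rw [σ.injective.eq_iff, Equiv.injective _ |>.eq_iff]
        · have h1 := hfp y y.2
          have h2 := hfp y' y'.2
          simp only [Equiv.Perm.subtypePerm_apply]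
          rw [h1, h2, f.injective.eq_iff]
      · refine and_congr (not_congr ?_) ?_
        · rw [Equiv.injective _ |>.eq_iff]
        · simp only [Equiv.Perm.subtypePerm_apply]
          rw [hfr y y.2, hfr y' y'.2, f.injective.eq_iff]) with h1 | h1
  · exact hp.fibreGraph_ne (hU.two_le_ncard_cell hadj.symm) hlt h1
  · exact hre.fibreGraph_ne (hU.two_le_ncard_cell hw) (hroot.trans_lt hlt) h1

/-- The stars between a processed cell `d` and a new cell. -/
theorem IsRootMap.exists_star_map (hr : IsRootMap G l h P r)
    (hU : UniqueRealization G (wlColour G l h)) (hc₀ : c₀ ∉ P) (hd : d ∈ P)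
    (hadj : (anisoGraph G l h).Adj d c₀) :
    ∃ (p : V → V) (ε : Prop), IsEquitableMap (wlColour G l h) c₀ d p ∧
      ∀ x y, wlColour G l h x = d → wlColour G l h y = c₀ → (G.Adj x y ↔ (ε ↔ x = p y)) :=
  hU.exists_star_map hadj.ne hadj.2.1 hadj.2.2 (hr.ncard_cell_le hU hc₀ hd hadj)

/-- A cell joined to a processed cell is homogeneous: otherwise, its graph could be overlaid in
different ways with its partition by the first cell `x` of the component or, if it has the same size
as `x`, with the graph of `x`, which is heterogeneous by the choice of the first cell. -/
theorem IsRootMap.not_heterogeneous (hr : IsRootMap G l h P r)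
    (hU : UniqueRealization G (wlColour G l h)) (hc₀ : c₀ ∉ P) (hd : d ∈ P)
    (hadj : (anisoGraph G l h).Adj d c₀) : ¬ Heterogeneous G l h c₀ := by
  intro hhet
  obtain ⟨y, hy, y₀, hy₀, -⟩ := hadj.2.1
  have hyP : wlColour G l h y ∈ P := (show wlColour G l h y = d from hy) ▸ hd
  obtain ⟨p, ε, hp, hε⟩ := hr.exists_star_map hU hc₀ hd hadj
  set x := wlColour G l h (r y) with hx
  have hrd : (anisoGraph G l h).Reachable d x := by
    have := hr.reachable y hyP
    rwa [show wlColour G l h y = d from hy] at this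
  have hxc : (anisoGraph G l h).Reachable x c₀ := hrd.symm.trans hadj.reachable
  have hroot := (hr.root y hyP).1 c₀ hxc
  obtain ⟨w, hw⟩ := exists_adj_of_reachable hrd.symm hadj
  have hre := hr.equitable y hyP
  rw [show wlColour G l h y = d from hy] at hre
  have hF := hp.comp hre
  have htwist : ∀ σ : Equiv.Perm {v // wlColour G l h v = c₀}, ∃ f : Equiv.Perm V,
      ∃ hf : ∀ v, wlColour G l h (f v) = wlColour G l h v,
      (∀ z (hz : wlColour G l h z = c₀), (r ∘ p) (σ ⟨f z, (hf z).trans hz⟩) = f ((r ∘ p) z)) ∧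
      (∀ u v, wlColour G l h u = c₀ → wlColour G l h v = c₀ → (G.Adj (f u) (f v) ↔ G.Adj u v)) ∧
      (∀ u v, wlColour G l h u ∈ P → wlColour G l h v ∈ P → (G.Adj (f u) (f v) ↔ G.Adj u v)) := by
    intro σ
    obtain ⟨f, hf, hfp, hfo⟩ := hU.exists_perm_of_twist_star hadj.ne hp hε σ
    have hfP : ∀ u v, wlColour G l h u ∈ P → wlColour G l h v ∈ P →
        (G.Adj (f u) (f v) ↔ G.Adj u v) := fun a b ha hb => hfo a b
      (fun e => hc₀ (e.2 ▸ hb)) (fun e => hc₀ (e.1 ▸ ha))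
    refine ⟨f, hf, fun z hz => ?_, fun a b ha hb => hfo a b ?_ ?_, hfP⟩
    · rw [Function.comp_apply, hfp z hz]
      refine hr.equivariant f hf hfP _ ?_
      rw [hp.maps z hz]
      exact hd
    · exact fun e => hadj.ne (e.1.symm.trans ha)
    · exact fun e => hadj.ne (e.2.symm.trans hb)
  rcases hroot.lt_or_eq with hlt | heq
  · rcases SimpleGraph.homogeneous_of_forall_overlay (fibreGraph (wlColour G l h) c₀ (r ∘ p))
      (G.comap Subtype.val) hF.fibreGraph_regular (hU.induce_regular c₀) (by
        intro σ
        obtain ⟨f, hf, hfp, hfc, -⟩ := htwist σ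
        refine ⟨f.subtypePerm fun x => by rw [hf], fun y y' => ?_, fun y y' => hfc _ _ y.2 y'.2⟩
        refine and_congr (not_congr ?_) ?_
        · rw [σ.injective.eq_iff, Equiv.injective _ |>.eq_iff]
        · have h1 := hfp y y.2
          have h2 := hfp y' y'.2
          simp only [Equiv.Perm.subtypePerm_apply]
          rw [h1, h2, f.injective.eq_iff]) with h1 | h1
    · exact hF.fibreGraph_ne (hU.two_le_ncard_cell hw) hlt h1
    · exact hhet.induce_ne h1
  · have hxhet : Heterogeneous G l h x := (hr.root y hyP).2 ⟨c₀, hxc, heq.symm, hhet⟩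
    have hxP : ∀ v, wlColour G l h v = x → wlColour G l h v ∈ P := fun v hv =>
      hv ▸ hr.mem y hyP
    -- since the cells have the same size, `r ∘ p` is a bijection between them
    have hbij : Function.Bijective fun z : {v // wlColour G l h v = c₀} =>
        (⟨(r ∘ p) z, hF.maps z z.2⟩ : {v // wlColour G l h v = x}) := by
      refine Function.Surjective.bijective_of_nat_card_le (fun z => ?_) heq.symm.le
      obtain ⟨z', hz', hzz⟩ := hF.exists_eq hy₀ z.2
      exact ⟨⟨z', hz'⟩, Subtype.ext hzz⟩
    let E := Equiv.ofBijective _ hbij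
    let I : G.comap (fun z : {v // wlColour G l h v = c₀} => (r ∘ p) z) ≃g
        (G.comap Subtype.val : SimpleGraph {v // wlColour G l h v = x}) :=
      ⟨E, by intro a b; rfl⟩
    rcases SimpleGraph.homogeneous_of_forall_overlay
      (G.comap fun z : {v // wlColour G l h v = c₀} => (r ∘ p) z)
      (G.comap Subtype.val) (I.regular (hU.induce_regular x)) (hU.induce_regular c₀) (by
        intro σ
        obtain ⟨f, hf, hfp, hfc, hfP⟩ := htwist σ
        refine ⟨f.subtypePerm fun x => by rw [hf], fun y y' => ?_, fun y y' => hfc _ _ y.2 y'.2⟩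
        have h1 := hfp y y.2
        have h2 := hfp y' y'.2
        simp only [Equiv.Perm.subtypePerm_apply, SimpleGraph.comap_adj]
        rw [h1, h2]
        exact hfP _ _ (hxP _ (hF.maps y y.2)) (hxP _ (hF.maps y' y'.2))) with h1 | h1
    · exact hxhet.induce_ne (I.eq_bot_or_eq_top h1)
    · exact hhet.induce_ne h1

/-- A new cell is joined to at most one processed cell: if it were joined to two of them, then the
two resulting maps to the first cell of the component would agree in a number of vertices that can
be changed. -/
theorem IsRootMap.eq_of_adj (hr : IsRootMap G l h P r)
    (hU : UniqueRealization G (wlColour G l h)) (hc₀ : c₀ ∉ P) (hd : d ∈ P)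
    (hadj : (anisoGraph G l h).Adj d c₀) {d' : WLColour L h} (hd' : d' ∈ P)
    (hadj' : (anisoGraph G l h).Adj d' c₀) : d' = d := by
  by_contra hne
  obtain ⟨y, hy, y₀, hy₀, -⟩ := hadj.2.1
  obtain ⟨y', hy', -⟩ := hadj'.2.1
  have hyP : wlColour G l h y ∈ P := (show wlColour G l h y = d from hy) ▸ hd
  have hyP' : wlColour G l h y' ∈ P := (show wlColour G l h y' = d' from hy') ▸ hd'
  obtain ⟨p, ε, hp, hε⟩ := hr.exists_star_map hU hc₀ hd hadj
  obtain ⟨p', ε', hp', hε'⟩ := hr.exists_star_map hU hc₀ hd' hadj'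
  have hx : wlColour G l h (r y') = wlColour G l h (r y) := by
    refine hr.root_eq _ _ hyP' hyP ?_
    rw [show wlColour G l h y = d from hy, show wlColour G l h y' = d' from hy']
    exact hadj'.reachable.trans hadj.symm.reachable
  set x := wlColour G l h (r y) with hxdef
  have hrd : (anisoGraph G l h).Reachable d x := by
    have := hr.reachable y hyP
    rwa [show wlColour G l h y = d from hy] at this
  obtain ⟨w, hw⟩ := exists_adj_of_reachable hrd.symm hadj
  have hre := hr.equitable y hyP
  rw [show wlColour G l h y = d from hy] at hre
  have hre' := hr.equitable y' hyP'
  rw [show wlColour G l h y' = d' from hy', hx] at hre'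
  have hF := hp.comp hre
  have hF' := hp'.comp hre'
  have hnt : Nontrivial {v // wlColour G l h v = x} :=
    Finite.one_lt_card_iff_nontrivial.1 (hU.two_le_ncard_cell hw)
  obtain ⟨σ, hσ⟩ := exists_card_agree_ne
    (F := fun z : {v // wlColour G l h v = c₀} =>
      (⟨(r ∘ p) z, hF.maps z z.2⟩ : {v // wlColour G l h v = x}))
    (F' := fun z : {v // wlColour G l h v = c₀} =>
      (⟨(r ∘ p') z, hF'.maps z z.2⟩ : {v // wlColour G l h v = x}))
    (fun z => by
      obtain ⟨z', hz', hzz⟩ := hF.exists_eq hy₀ z.2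
      exact ⟨⟨z', hz'⟩, Subtype.ext hzz⟩)
    (fun z => by
      obtain ⟨z', hz', hzz⟩ := hF'.exists_eq hy₀ z.2
      exact ⟨⟨z', hz'⟩, Subtype.ext hzz⟩)
  obtain ⟨f, hf, hfp, hfo⟩ := hU.exists_perm_of_twist_star hadj.ne hp hε σ
  have hfr := hr.equivariant f hf fun a b ha hb => hfo a b
      (fun e => hc₀ (e.2 ▸ hb)) (fun e => hc₀ (e.1 ▸ ha))
  have hfp' : ∀ z, wlColour G l h z = c₀ → p' (f z) = f (p' z) := by
    intro z hz
    have h1 := hfo (p' z) z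
      (fun e => hne ((hp'.maps z hz).symm.trans e.1))
      (fun e => hadj.ne (e.2.symm.trans hz))
    rw [hε' _ _ ((hf _).trans (hp'.maps z hz)) ((hf _).trans hz), hε' _ _ (hp'.maps z hz) hz] at h1
    by_contra hcon
    simp [Ne.symm hcon] at h1
  refine hσ (card_subtype_congr (f.subtypePerm fun x => by rw [hf]) fun z => ?_).symm
  simp only [Set.mem_ofPred_eq, Equiv.Perm.subtypePerm_apply, Function.comp_apply, Subtype.ext_iff]
  have hz := hfp z z.2
  have hpz : wlColour G l h (p z) ∈ P := by rw [hp.maps z z.2]; exact hd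
  have hpz' : wlColour G l h (p' z) ∈ P := by rw [hp'.maps z z.2]; exact hd'
  rw [hz, hfp' z z.2, hfr _ hpz, hfr _ hpz', f.injective.eq_iff]

end Cells

/-! ### Extending partial isomorphisms to the next cell -/

section Extension

variable {V L : Type*} [Fintype V] {G : SimpleGraph V} {l : V → L} {h : ℕ}
  {P : Set (WLColour L h)} {r : V → V} {c₀ : WLColour L h}

theorem IsRootMap.insert_of_adj (hr : IsRootMap G l h P r)
    (hU : UniqueRealization G (wlColour G l h)) (hc₀ : c₀ ∉ P) {d : WLColour L h} (hd : d ∈ P)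
    (hadj : (anisoGraph G l h).Adj d c₀) : ∃ r', IsRootMap G l h (insert c₀ P) r' := by
  classical
  obtain ⟨p, ε, hp, hε⟩ := hr.exists_star_map hU hc₀ hd hadj
  let r' : V → V := fun u => if wlColour G l h u = c₀ then r (p u) else r u
  have hnew : ∀ u, wlColour G l h u = c₀ → r' u = r (p u) := fun u hu => by simp [r', hu]
  have hold : ∀ u, wlColour G l h u ∈ P → r' u = r u := fun u hu =>
    if_neg fun e : wlColour G l h u = c₀ => hc₀ (e ▸ hu)
  -- every processed vertex has the same image as an already processed vertex of its component
  have hrep : ∀ u, wlColour G l h u ∈ insert c₀ P → ∃ w, wlColour G l h w ∈ P ∧ r' u = r w ∧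
      (anisoGraph G l h).Reachable (wlColour G l h u) (wlColour G l h w) := by
    rintro u (hu | hu)
    · refine ⟨p u, ?_, hnew u hu, ?_⟩
      · rw [hp.maps u hu]; exact hd
      · rw [hp.maps u hu, hu]; exact hadj.symm.reachable
    · exact ⟨u, hu, hold u hu, SimpleGraph.Reachable.refl _⟩
  refine ⟨r', fun u hu => ?_, fun u hu => ?_, fun u hu => ?_, fun u v hu hv huv => ?_, ?_, ?_⟩
  · obtain ⟨w, hw, he, -⟩ := hrep u hu
    exact he ▸ Or.inr (hr.mem w hw)
  · obtain ⟨w, hw, he, -⟩ := hrep u hu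
    exact he ▸ hr.root w hw
  · obtain ⟨w, hw, he, hre⟩ := hrep u hu
    exact he ▸ hre.trans (hr.reachable w hw)
  · obtain ⟨w, hw, he, hre⟩ := hrep u hu
    obtain ⟨z, hz, he', hre'⟩ := hrep v hv
    rw [he, he']
    exact hr.root_eq w z hw hz (hre.symm.trans (huv.trans hre'))
  · rintro u (hu | hu)
    · have hpu : wlColour G l h (p u) ∈ P := by rw [hp.maps u hu]; exact hd
      have hre := hr.equitable (p u) hpu
      rw [hp.maps u hu] at hre
      have hcomp := hp.comp hre
      rw [hnew u hu, hu]
      refine ⟨fun y hy => hnew y hy ▸ hcomp.maps y hy, fun x x' hx hx' => ?_⟩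
      have hset : ∀ x, {y | wlColour G l h y = c₀ ∧ r' y = x} =
          {y | wlColour G l h y = c₀ ∧ (r ∘ p) y = x} := fun x =>
        Set.ext fun y => and_congr_right fun hy => by rw [hnew y hy]; rfl
      rw [hset, hset, hcomp.fibre x x' hx hx']
    · have hre := hr.equitable u hu
      rw [hold u hu]
      refine ⟨fun y hy => hold y (hy ▸ hu) ▸ hre.maps y hy, fun x x' hx hx' => ?_⟩
      have hset : ∀ x, {y | wlColour G l h y = wlColour G l h u ∧ r' y = x} =
          {y | wlColour G l h y = wlColour G l h u ∧ r y = x} := fun x =>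
        Set.ext fun y => and_congr_right fun hy => by rw [hold y (hy ▸ hu)]
      rw [hset, hset, hre.fibre x x' hx hx']
  · intro f hf hfP
    have hfr := hr.equivariant f hf fun a b ha hb => hfP a b (Or.inr ha) (Or.inr hb)
    rintro u (hu | hu)
    · have hpu := hp.maps u hu
      have h1 := hfP (p u) u (Or.inr (by rw [hpu]; exact hd)) (Or.inl hu)
      rw [hε _ _ ((hf _).trans hpu) ((hf _).trans hu), hε _ _ hpu hu] at h1
      have h2 : f (p u) = p (f u) := by
        by_contra hne
        simp [hne] at h1
      rw [hnew _ ((hf u).trans hu), hnew u hu, ← h2, hfr _ (by rw [hpu]; exact hd)]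
    · rw [hold u hu, hold (f u) (by rwa [hf]), hfr u hu]

theorem IsRootMap.insert_of_isComponentRoot (hr : IsRootMap G l h P r) (hc₀ : c₀ ∉ P)
    (hP : ∀ d ∈ P, ¬ (anisoGraph G l h).Reachable c₀ d) (hroot : IsComponentRoot G l h c₀) :
    ∃ r', IsRootMap G l h (insert c₀ P) r' := by
  classical
  let r' : V → V := fun u => if wlColour G l h u = c₀ then u else r u
  have hnew : ∀ u, wlColour G l h u = c₀ → r' u = u := fun u hu => by simp [r', hu]
  have hold : ∀ u, wlColour G l h u ∈ P → r' u = r u := fun u hu =>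
    if_neg fun e : wlColour G l h u = c₀ => hc₀ (e ▸ hu)
  refine ⟨r', ?_, ?_, ?_, ?_, ?_, ?_⟩
  · rintro u (hu | hu)
    · rw [hnew u hu]; exact Or.inl hu
    · rw [hold u hu]; exact Or.inr (hr.mem u hu)
  · rintro u (hu | hu)
    · rw [hnew u hu, hu]; exact hroot
    · rw [hold u hu]; exact hr.root u hu
  · rintro u (hu | hu)
    · rw [hnew u hu]
    · rw [hold u hu]; exact hr.reachable u hu
  · rintro u v (hu | hu) (hv | hv) huv
    · rw [hnew u hu, hnew v hv, hu, hv]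
    · exact absurd (hu ▸ huv) (hP _ hv)
    · exact absurd (hv ▸ huv.symm) (hP _ hu)
    · rw [hold u hu, hold v hv]; exact hr.root_eq u v hu hv huv
  · rintro u (hu | hu)
    · rw [hnew u hu, hu]
      refine ⟨fun y hy => by rw [hnew y hy, hy], fun x x' hx hx' => ?_⟩
      have hset : ∀ x, wlColour G l h x = c₀ → {y | wlColour G l h y = c₀ ∧ r' y = x} = {x} := by
        intro x hx
        ext y
        simp only [Set.mem_ofPred_eq, Set.mem_singleton_iff]
        exact ⟨fun hy => (hnew y hy.1).symm.trans hy.2, fun hy => by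
          subst hy; exact ⟨hx, hnew _ hx⟩⟩
      rw [hset x hx, hset x' hx', Set.ncard_singleton, Set.ncard_singleton]
    · have hre := hr.equitable u hu
      rw [hold u hu]
      refine ⟨fun y hy => hold y (hy ▸ hu) ▸ hre.maps y hy, fun x x' hx hx' => ?_⟩
      have hset : ∀ x, {y | wlColour G l h y = wlColour G l h u ∧ r' y = x} =
          {y | wlColour G l h y = wlColour G l h u ∧ r y = x} := fun x =>
        Set.ext fun y => and_congr_right fun hy => by rw [hold y (hy ▸ hu)]
      rw [hset, hset, hre.fibre x x' hx hx']
  · intro f hf hfP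
    have hfr := hr.equivariant f hf fun a b ha hb => hfP a b (Or.inr ha) (Or.inr hb)
    rintro u (hu | hu)
    · rw [hnew _ ((hf u).trans hu), hnew u hu]
    · rw [hold u hu, hold (f u) (by rwa [hf]), hfr u hu]

theorem IsRootMap.insert (hr : IsRootMap G l h P r) (hU : UniqueRealization G (wlColour G l h))
    (hc₀ : c₀ ∉ P) (hmay : MayProcess G l h P c₀) : ∃ r', IsRootMap G l h (insert c₀ P) r' := by
  rcases hmay with ⟨d, hd, hadj⟩ | ⟨hP, hroot⟩
  · exact hr.insert_of_adj hU hc₀ hd hadj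
  · exact hr.insert_of_isComponentRoot hc₀ hP hroot

/-- Between two cells that are not joined in the anisotropic graph, there are no or all edges. -/
theorem adj_iff_adj_of_not_aniso {d e : WLColour L h} (hde : d ≠ e)
    (hn : ¬ (anisoGraph G l h).Adj d e) {u u' v v' : V} (hu : wlColour G l h u = d)
    (hu' : wlColour G l h u' = d) (hv : wlColour G l h v = e) (hv' : wlColour G l h v' = e) :
    G.Adj u v ↔ G.Adj u' v' := by
  by_contra hne
  rw [← xor_iff_not_iff] at hne
  rcases hne with ⟨h1, h2⟩ | ⟨h1, h2⟩
  · exact hn ⟨hde, ⟨u, hu, v, hv, h1⟩, ⟨u', hu', v', hv', h2⟩⟩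
  · exact hn ⟨hde, ⟨u', hu', v', hv', h1⟩, ⟨u, hu, v, hv, h2⟩⟩

/-- Any permutation `g` of the centres of stars of equal size lifts to a permutation of the
leaves. -/
theorem IsEquitableMap.exists_lift {K : Type*} {c : V → K} {e d : K} {p : V → V}
    (hp : IsEquitableMap c e d p) {g : V → V} (hg : ∀ u, c u = d → c (g u) = d)
    (hgi : ∀ u v, c u = d → c v = d → g u = g v → u = v) :
    ∃ σ : Equiv.Perm {v // c v = e}, ∀ y, p (σ y) = g (p y) := by
  have hcard : ∀ q : V → Prop, Nat.card {y : {v // c v = e} // q y} = {y | c y = e ∧ q y}.ncard :=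
    fun q => Nat.card_congr (Equiv.subtypeSubtypeEquivSubtypeInter _ q)
  have hsurj : Function.Surjective fun u : {v // c v = d} => (⟨g u, hg u u.2⟩ : {v // c v = d}) :=
    Finite.surjective_of_injective fun u v huv =>
      Subtype.ext (hgi u v u.2 v.2 (congrArg Subtype.val huv))
  have hfib : ∀ z,
      Nonempty ({y : {v // c v = e} // g (p y) = z} ≃ {y : {v // c v = e} // p y = z}) := by
    intro z
    rw [← Finite.card_eq, hcard fun y => g (p y) = z, hcard fun y => p y = z]
    by_cases hz : c z = d
    · obtain ⟨x, hx⟩ := hsurj ⟨z, hz⟩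
      have hx' : g x = z := congrArg Subtype.val hx
      rw [hp.fibre z x hz x.2]
      congr 1
      ext y
      refine and_congr_right fun hy => ⟨fun h1 => ?_, fun h1 => by rw [h1, hx']⟩
      exact hgi _ _ (hp.maps y hy) x.2 (h1.trans hx'.symm)
    · congr 1
      ext y
      refine and_congr_right fun hy => ⟨fun h1 => ?_, fun h1 => ?_⟩
      · exact absurd (h1 ▸ hg _ (hp.maps y hy)) hz
      · exact absurd (h1 ▸ hp.maps y hy) hz
  let E : ∀ z, {y : {v // c v = e} // g (p y) = z} ≃ {y : {v // c v = e} // p y = z} :=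
    fun z => (hfib z).some
  exact ⟨Equiv.ofFiberEquiv E, Equiv.ofFiberEquiv_map E⟩

/-- Whenever a cell may be processed, every injective colour-preserving map `g` of the processed
cells extends to it in such a way that the edges at the new cell are preserved. -/
theorem IsRootMap.exists_extension (hr : IsRootMap G l h P r)
    (hU : UniqueRealization G (wlColour G l h)) (hc₀ : c₀ ∉ P) (hmay : MayProcess G l h P c₀)
    {g : V → V} (hg : ∀ u, wlColour G l h u ∈ P → wlColour G l h (g u) = wlColour G l h u)
    (hgi : ∀ u v, wlColour G l h u ∈ P → wlColour G l h v ∈ P → g u = g v → u = v) :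
    ∃ σ : Equiv.Perm {v // wlColour G l h v = c₀},
      (∀ y y', G.Adj (σ y) (σ y') ↔ G.Adj y y') ∧
      ∀ y u, wlColour G l h u ∈ P → (G.Adj (σ y) (g u) ↔ G.Adj y u) := by
  rcases hmay with ⟨d, hd, hadj⟩ | ⟨hP, -⟩
  · obtain ⟨p, ε, hp, hε⟩ := hr.exists_star_map hU hc₀ hd hadj
    obtain ⟨σ, hσ⟩ := hp.exists_lift (g := g) (fun u hu => (hg u (hu ▸ hd)).trans hu)
      (fun u v hu hv => hgi u v (hu ▸ hd) (hv ▸ hd))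
    refine ⟨σ, fun y y' => ?_, fun y u hu => ?_⟩
    · have hhom := hr.not_heterogeneous hU hc₀ hd hadj
      rcases eq_or_ne y y' with rfl | hne
      · simp
      have hne' : (σ y : V) ≠ σ y' := fun e => hne (σ.injective (Subtype.ext e))
      have hne'' : (y : V) ≠ y' := fun e => hne (Subtype.ext e)
      by_contra hcon
      rw [← xor_iff_not_iff] at hcon
      rcases hcon with ⟨h1, h2⟩ | ⟨h1, h2⟩
      · exact hhom ⟨⟨_, (σ y).2, _, (σ y').2, h1⟩, ⟨_, y.2, _, y'.2, hne'', h2⟩⟩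
      · exact hhom ⟨⟨_, y.2, _, y'.2, h1⟩, ⟨_, (σ y).2, _, (σ y').2, hne', h2⟩⟩
    · rw [G.adj_comm, G.adj_comm y.1 u]
      by_cases hud : wlColour G l h u = d
      · rw [hε _ _ ((hg u hu).trans hud) (σ y).2, hε _ _ hud y.2, hσ]
        refine iff_congr Iff.rfl ⟨fun h1 => ?_, fun h1 => by rw [h1]⟩
        exact hgi _ _ hu (by rw [hp.maps _ y.2]; exact hd) h1
      · refine adj_iff_adj_of_not_aniso (d := wlColour G l h u) (e := c₀)
          (fun e => hc₀ (e ▸ hu)) (fun hcon => hud ?_) (hg u hu) rfl (σ y).2 y.2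
        exact hr.eq_of_adj hU hc₀ hd hadj hu hcon
  · refine ⟨1, fun _ _ => Iff.rfl, fun y u hu => ?_⟩
    rw [G.adj_comm, G.adj_comm y.1 u]
    exact adj_iff_adj_of_not_aniso (d := wlColour G l h u) (e := c₀) (fun e => hc₀ (e ▸ hu))
      (fun hcon => hP _ hu hcon.symm.reachable) (hg u hu) rfl y.2 y.2

end Extension

/-! ### Complete runs of the algorithm -/

section Runs

theorem exists_isPairing {α β : Type*} (A : Set α) (B : Set β) : ∃ X, IsPairing A B X := by
  rcases Function.Embedding.total A B with ⟨⟨f⟩⟩ | ⟨⟨f⟩⟩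
  · refine ⟨Set.range fun a : A => ((a : α), (f a : β)), ?_, ?_, ?_, Or.inl ?_⟩
    · rintro _ ⟨a, rfl⟩
      exact ⟨a.2, (f a).2⟩
    · rintro a b b' ⟨x, hx⟩ ⟨y, hy⟩
      simp only [Prod.mk.injEq] at hx hy
      rw [← hx.2, ← hy.2, Subtype.ext (hx.1.trans hy.1.symm)]
    · rintro a a' b ⟨x, hx⟩ ⟨y, hy⟩
      simp only [Prod.mk.injEq] at hx hy
      rw [← hx.1, ← hy.1, f.injective (Subtype.ext (hx.2.trans hy.2.symm))]
    · intro a ha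
      exact ⟨_, ⟨⟨a, ha⟩, rfl⟩, rfl⟩
  · refine ⟨Set.range fun b : B => ((f b : α), (b : β)), ?_, ?_, ?_, Or.inr ?_⟩
    · rintro _ ⟨b, rfl⟩
      exact ⟨(f b).2, b.2⟩
    · rintro a b b' ⟨x, hx⟩ ⟨y, hy⟩
      simp only [Prod.mk.injEq] at hx hy
      rw [← hx.2, ← hy.2, f.injective (Subtype.ext (hx.1.trans hy.1.symm))]
    · rintro a a' b ⟨x, hx⟩ ⟨y, hy⟩
      simp only [Prod.mk.injEq] at hx hy
      rw [← hx.1, ← hy.1, Subtype.ext (hx.2.trans hy.2.symm)]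
    · intro b hb
      exact ⟨_, ⟨⟨b, hb⟩, rfl⟩, rfl⟩

theorem exists_isModifiedPairing {V W : Type*} (G : SimpleGraph V) (H : SimpleGraph W)
    (M : Set ((V ⊕ W) × (W ⊕ V))) (A : Set (V ⊕ W)) (B : Set (W ⊕ V)) :
    ∃ X, IsModifiedPairing G H M A B X := by
  by_cases hY : ∃ Y, IsPairing A B Y ∧ RespectsEdges G H M Y
  · obtain ⟨Y, h1, h2⟩ := hY
    exact ⟨Y, h1, fun _ => h2⟩
  · obtain ⟨X, hX⟩ := exists_isPairing A B
    exact ⟨X, hX, fun h => absurd h hY⟩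

variable {V W L : Type*} [Fintype V] [Fintype W] {G : SimpleGraph V} {lG : V → L}
  {H : SimpleGraph W} {lH : W → L} {h : ℕ}

/-- As long as colours remain, one of them may be processed. -/
theorem exists_mayProcess (G : SimpleGraph V) (l : V → L) {Q : Set (WLColour L h)} (hfin : Q.Finite)
    (hne : Q.Nonempty) : ∃ c ∈ Q, MayProcess G l h Qᶜ c := by
  classical
  by_cases hadj : ∃ c ∈ Q, ∃ d ∈ Qᶜ, (anisoGraph G l h).Adj d c
  · obtain ⟨c, hc, hd⟩ := hadj
    exact ⟨c, hc, Or.inl hd⟩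
  push Not at hadj
  have hclosed : ∀ c d, (anisoGraph G l h).Reachable c d → c ∈ Q → d ∈ Q := by
    rintro c d ⟨p⟩ hc
    induction p with
    | nil => exact hc
    | cons hcd _ ih =>
      refine ih (by_contra fun hd => ?_)
      exact hadj _ hc _ hd hcd.symm
  obtain ⟨c, hc⟩ := hne
  -- a cell of minimum size, and among those a heterogeneous one if there is any
  obtain ⟨e, he, hmin⟩ := Set.exists_min_image {d | (anisoGraph G l h).Reachable c d}
    (fun d => 2 * (cell G l h d).ncard + if Heterogeneous G l h d then 0 else 1)
    (hfin.subset fun d hd => hclosed c d hd hc) ⟨c, SimpleGraph.Reachable.refl c⟩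
  refine ⟨e, hclosed c e he hc, Or.inr ⟨fun d hd hed => hd (hclosed e d hed (hclosed c e he hc)),
    fun d hed => ?_, ?_⟩⟩
  · have := hmin d (SimpleGraph.Reachable.trans he hed)
    split_ifs at this <;> omega
  · rintro ⟨d, hed, hcard, hhet⟩
    have := hmin d (SimpleGraph.Reachable.trans he hed)
    by_contra hcon
    simp only [hhet, hcon, if_true, if_false, hcard] at this
    omega

/-- The number of tree edges between a node and the root. -/
def WLNode.depth : WLNode L → ℕ
  | .root => 0
  | .indel => 1
  | .colour i _ => i + 1

theorem WLNode.depth_parent {k : WLNode L} (hk : k ≠ .root) : k.parent.depth + 1 = k.depth := by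
  cases k with
  | root => exact absurd rfl hk
  | indel => rfl
  | colour i c => cases i <;> rfl

theorem wlTree_adj {a b : WLNode L} :
    (wlTree L).Adj a b ↔ a ≠ b ∧ (a.parent = b ∨ b.parent = a) :=
  SimpleGraph.fromRel_adj _ _ _

theorem finite_wlTreeNodes : (wlTreeNodes G lG H lH h).Finite := by
  have hfin : ((({.root, .indel} : Set (WLNode L)) ∪
      ⋃ i ∈ Set.Iic h, Set.range fun v => WLNode.colour i (wlColour G lG i v)) ∪
      ⋃ i ∈ Set.Iic h, Set.range fun w => WLNode.colour i (wlColour H lH i w)).Finite :=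
    ((Set.toFinite _).union ((Set.finite_Iic h).biUnion fun _ _ => Set.finite_range _)).union
      ((Set.finite_Iic h).biUnion fun _ _ => Set.finite_range _)
  refine hfin.subset ?_
  rintro k (rfl | rfl | ⟨i, hi, v, rfl⟩ | ⟨i, hi, w, rfl⟩)
  · simp
  · simp
  · exact Or.inl (Or.inr (Set.mem_biUnion hi ⟨v, rfl⟩))
  · exact Or.inr (Set.mem_biUnion hi ⟨w, rfl⟩)

theorem parent_mem_wlTreeNodes {k : WLNode L} (hk : k ∈ wlTreeNodes G lG H lH h) :
    k.parent ∈ wlTreeNodes G lG H lH h := by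
  rcases hk with rfl | rfl | ⟨i, hi, v, rfl⟩ | ⟨i, hi, w, rfl⟩
  · exact Or.inl rfl
  · exact Or.inl rfl
  · cases i with
    | zero => exact Or.inl rfl
    | succ i => exact Or.inr (Or.inr (Or.inl ⟨i, by omega, v, rfl⟩))
  · cases i with
    | zero => exact Or.inl rfl
    | succ i => exact Or.inr (Or.inr (Or.inr ⟨i, by omega, w, rfl⟩))

theorem depth_le_of_mem_wlTreeNodes {k : WLNode L} (hk : k ∈ wlTreeNodes G lG H lH h) :
    k.depth ≤ h + 1 := by
  rcases hk with rfl | rfl | ⟨i, hi, v, rfl⟩ | ⟨i, hi, w, rfl⟩ <;> simp [WLNode.depth] <;> omega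

/-- If a node besides the root remains, then some node without remaining children may be selected: a
permitted colour of the last round as long as there is one, and otherwise any node of maximum
depth. -/
theorem exists_leaf (G : SimpleGraph V) (lG : V → L) {S : Set (WLNode L)} (hfin : S.Finite)
    (hdepth : ∀ k ∈ S, k.depth ≤ h + 1) (hne : ∃ k ∈ S, k ≠ .root) :
    ∃ k ∈ S, k ≠ .root ∧ MaySelect G lG h S k ∧ ∀ j ∈ S, j ≠ .root → j.parent ≠ k := by
  have hmax : ∀ k, k ≠ .root → (∀ j ∈ S, j.depth ≤ k.depth) → ∀ j ∈ S, j ≠ .root →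
      j.parent ≠ k := by
    intro k _ hk j hj hj0 hjk
    have h1 := hk j hj
    have h2 := WLNode.depth_parent hj0
    rw [hjk] at h2
    omega
  by_cases hQ : ∃ c, WLNode.colour h c ∈ S
  · have hQfin : {c | WLNode.colour h c ∈ S}.Finite :=
      hfin.preimage fun c _ d _ hcd => by simpa using hcd
    obtain ⟨c, hc, hmay⟩ := exists_mayProcess G lG hQfin hQ
    refine ⟨.colour h c, hc, by simp, fun d hd => ?_, hmax _ (by simp) hdepth⟩
    have hcd : c = d := by simpa using hd
    exact hcd ▸ hmay
  · push Not at hQ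
    obtain ⟨k, ⟨hk, hk0⟩, hkmax⟩ := Set.exists_max_image (S \ {.root}) WLNode.depth
      (hfin.subset Set.sdiff_subset) (by obtain ⟨k, hk, hk0⟩ := hne; exact ⟨k, hk, hk0⟩)
    refine ⟨k, hk, hk0, fun c hc => absurd (hc ▸ hk) (hQ c), hmax k hk0 fun j hj => ?_⟩
    by_cases hj0 : j = .root
    · rw [hj0]
      exact Nat.zero_le _
    · exact hkmax j ⟨hj, hj0⟩

/-- A run can be completed from every state whose remaining nodes form a subtree with the same
root. -/
theorem exists_complete_run (s : AssignState V W L) (hfin : s.nodes.Finite)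
    (hdepth : ∀ k ∈ s.nodes, k.depth ≤ h + 1)
    (hroot : .root ∈ s.nodes) (hparent : ∀ k ∈ s.nodes, k.parent ∈ s.nodes) :
    ∃ s', Relation.ReflTransGen (AssignStep G lG H h) s s' ∧ s'.nodes = ∅ := by
  induction hn : s.nodes.ncard generalizing s with
  | zero =>
    rw [Set.ncard_eq_zero hfin] at hn
    exact ⟨s, .refl, hn⟩
  | succ n ih =>
    by_cases hne : ∃ k ∈ s.nodes, k ≠ .root
    · obtain ⟨k, hk, hk0, hsel, hleaf⟩ := exists_leaf G lG hfin hdepth hne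
      obtain ⟨X, hX⟩ := exists_isModifiedPairing G H s.M (s.A k) (s.B k)
      have hkp : k ≠ k.parent := fun e => by
        have := WLNode.depth_parent hk0
        rw [← e] at this
        omega
      obtain ⟨t, ht, hstep⟩ : ∃ t, t.nodes = s.nodes \ {k} ∧ AssignStep G lG H h s t := by
        refine ⟨_, rfl, .leaf s k k.parent X hk (hparent k hk)
          (wlTree_adj.2 ⟨hkp, Or.inl rfl⟩) (fun n' hn' hadj => ?_) hsel hX⟩
        rcases wlTree_adj.1 hadj with ⟨-, h1 | h1⟩
        · exact h1.symm
        · by_cases hn0 : n' = .root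
          · subst hn0
            exact absurd h1.symm hk0
          · exact absurd h1 (hleaf n' hn' hn0)
      have hsub : t.nodes ⊆ s.nodes := ht ▸ Set.sdiff_subset
      obtain ⟨s', hs', hs0⟩ := ih t (hfin.subset hsub) (fun j hj => hdepth j (hsub hj))
        (ht ▸ ⟨hroot, hk0.symm⟩) (fun j hj => ht ▸ ⟨hparent j (hsub hj), fun hjk => by
          by_cases hj0 : j = .root
          · subst hj0
            exact hk0 (Eq.symm hjk)
          · exact hleaf j (hsub hj) hj0 hjk⟩)
        (by rw [ht, Set.ncard_sdiff_singleton_of_mem hk, hn]; rfl)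
      exact ⟨s', .head hstep hs', hs0⟩
    · push Not at hne
      have hS : s.nodes = {.root} := Set.eq_singleton_iff_unique_mem.2 ⟨hroot, hne⟩
      obtain ⟨X, hX⟩ := exists_isModifiedPairing G H s.M (s.A .root) (s.B .root)
      exact ⟨_, .single (.last s .root X hS (fun c hc => by simp at hc) hX), rfl⟩

theorem exists_isAlgorithmOutput (G : SimpleGraph V) (lG : V → L) (H : SimpleGraph W) (lH : W → L)
    (h : ℕ) : ∃ M, IsAlgorithmOutput G lG H lH h M := by
  obtain ⟨s, hs, hs0⟩ := exists_complete_run (G := G) (lG := lG) (H := H) (h := h)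
    (initialState G lG H lH h) finite_wlTreeNodes (fun k hk => depth_le_of_mem_wlTreeNodes hk)
    (Or.inl rfl) (fun k hk => parent_mem_wlTreeNodes hk)
  exact ⟨s.M, s, hs, hs0, rfl⟩

end Runs

/-! ### The output is a one-to-one assignment -/

section Assignment

/-- If the two sets have the same size, then a pairing exhausts both. -/
theorem IsPairing.exhausted_both {α β : Type*} [Finite α] [Finite β] {A : Set α} {B : Set β}
    {X : Set (α × β)} (hX : IsPairing A B X) (hAB : A.ncard = B.ncard) :
    A = Prod.fst '' X ∧ B = Prod.snd '' X := by
  have h1 : Prod.fst '' X ⊆ A := by rintro _ ⟨x, hx, rfl⟩; exact (hX.subset hx).1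
  have h2 : Prod.snd '' X ⊆ B := by rintro _ ⟨x, hx, rfl⟩; exact (hX.subset hx).2
  have h3 : (Prod.fst '' X).ncard = X.ncard := Set.InjOn.ncard_image
    fun x hx y hy hxy => Prod.ext hxy (hX.left_unique x.1 x.2 y.2 hx (by rw [hxy]; exact hy))
  have h4 : (Prod.snd '' X).ncard = X.ncard := Set.InjOn.ncard_image
    fun x hx y hy hxy => Prod.ext (hX.right_unique x.1 y.1 x.2 hx (by rw [hxy]; exact hy)) hxy
  rcases hX.exhausted with h5 | h5
  · have h6 := h1.antisymm h5
    refine ⟨h6.symm, (Set.eq_of_subset_of_ncard_le h2 ?_ (Set.toFinite _)).symm⟩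
    rw [h4, ← h3, h6, hAB]
  · have h6 := h2.antisymm h5
    refine ⟨(Set.eq_of_subset_of_ncard_le h1 ?_ (Set.toFinite _)).symm, h6.symm⟩
    rw [h3, ← h4, h6, hAB]

variable {V W L : Type*}

/-- The unmatched objects are distributed among the remaining nodes, and the partial assignment is
one-to-one. -/
structure AssignState.Consistent (s : AssignState V W L) : Prop where
  cover_left : ∀ a, (∃ b, (a, b) ∈ s.M) ∨ ∃ k ∈ s.nodes, a ∈ s.A k
  cover_right : ∀ b, (∃ a, (a, b) ∈ s.M) ∨ ∃ k ∈ s.nodes, b ∈ s.B k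
  fresh_left : ∀ k ∈ s.nodes, ∀ a ∈ s.A k, ∀ b, (a, b) ∉ s.M
  fresh_right : ∀ k ∈ s.nodes, ∀ b ∈ s.B k, ∀ a, (a, b) ∉ s.M
  node_left : ∀ k ∈ s.nodes, ∀ k' ∈ s.nodes, ∀ a ∈ s.A k, a ∈ s.A k' → k = k'
  node_right : ∀ k ∈ s.nodes, ∀ k' ∈ s.nodes, ∀ b ∈ s.B k, b ∈ s.B k' → k = k'
  left_unique : ∀ a b b', (a, b) ∈ s.M → (a, b') ∈ s.M → b = b'
  right_unique : ∀ a a' b, (a, b) ∈ s.M → (a', b) ∈ s.M → a = a'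

theorem AssignState.Consistent.union_left_unique {s : AssignState V W L} (hs : s.Consistent)
    {k : WLNode L} (hk : k ∈ s.nodes) {X : Set ((V ⊕ W) × (W ⊕ V))}
    (hX : IsPairing (s.A k) (s.B k) X) (a : V ⊕ W) (b b' : W ⊕ V) (hb : (a, b) ∈ s.M ∪ X)
    (hb' : (a, b') ∈ s.M ∪ X) : b = b' := by
  rcases hb with hb | hb <;> rcases hb' with hb' | hb'
  · exact hs.left_unique a b b' hb hb'
  · exact absurd hb (hs.fresh_left k hk a (hX.subset hb').1 b)
  · exact absurd hb' (hs.fresh_left k hk a (hX.subset hb).1 b')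
  · exact hX.left_unique a b b' hb hb'

theorem AssignState.Consistent.union_right_unique {s : AssignState V W L} (hs : s.Consistent)
    {k : WLNode L} (hk : k ∈ s.nodes) {X : Set ((V ⊕ W) × (W ⊕ V))}
    (hX : IsPairing (s.A k) (s.B k) X) (a a' : V ⊕ W) (b : W ⊕ V) (ha : (a, b) ∈ s.M ∪ X)
    (ha' : (a', b) ∈ s.M ∪ X) : a = a' := by
  rcases ha with ha | ha <;> rcases ha' with ha' | ha'
  · exact hs.right_unique a a' b ha ha'
  · exact absurd ha (hs.fresh_right k hk b (hX.subset ha').2 a)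
  · exact absurd ha' (hs.fresh_right k hk b (hX.subset ha).2 a')
  · exact hX.right_unique a a' b ha ha'

end Assignment

section Output

variable {V W L : Type*} [Fintype V] [Fintype W] {G : SimpleGraph V} {lG : V → L}
  {H : SimpleGraph W} {lH : W → L} {h : ℕ}

theorem objectNode_mem_wlTreeNodes_left (a : V ⊕ W) :
    objectNode G lG h a ∈ wlTreeNodes G lG H lH h := by
  rcases a with v | w
  · exact Or.inr (Or.inr (Or.inl ⟨h, le_rfl, v, rfl⟩))
  · exact Or.inr (Or.inl rfl)

theorem objectNode_mem_wlTreeNodes_right (b : W ⊕ V) :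
    objectNode H lH h b ∈ wlTreeNodes G lG H lH h := by
  rcases b with w | v
  · exact Or.inr (Or.inr (Or.inr ⟨h, le_rfl, w, rfl⟩))
  · exact Or.inr (Or.inl rfl)

theorem consistent_initialState : (initialState G lG H lH h).Consistent where
  cover_left a := Or.inr ⟨_, objectNode_mem_wlTreeNodes_left a, rfl⟩
  cover_right b := Or.inr ⟨_, objectNode_mem_wlTreeNodes_right b, rfl⟩
  fresh_left _ _ _ _ _ h := h
  fresh_right _ _ _ _ _ h := h
  node_left _ _ _ _ _ h1 h2 := h1.symm.trans h2
  node_right _ _ _ _ _ h1 h2 := h1.symm.trans h2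
  left_unique _ _ _ h := h.elim
  right_unique _ _ _ h := h.elim

theorem AssignState.Consistent.step {s t : AssignState V W L} (hs : s.Consistent)
    (hst : AssignStep G lG H h s t) : t.Consistent := by
  cases hst with
  | leaf k n X hk hn hadj huniq hsel hX =>
    have hX := hX.1
    have hnk : n ≠ k := hadj.ne'
    have hout_left : ∀ j ∈ s.nodes, j ≠ k → ∀ a ∈ s.A j, ∀ b, (a, b) ∉ X :=
      fun j hj hjk a ha b hab => hjk (hs.node_left j hj k hk a ha (hX.subset hab).1)
    have hout_right : ∀ j ∈ s.nodes, j ≠ k → ∀ b ∈ s.B j, ∀ a, (a, b) ∉ X :=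
      fun j hj hjk b hb a hab => hjk (hs.node_right j hj k hk b hb (hX.subset hab).2)
    refine ⟨fun a => ?_, fun b => ?_, ?_, ?_, ?_, ?_, hs.union_left_unique hk hX,
      hs.union_right_unique hk hX⟩
    · rcases hs.cover_left a with ⟨b, hb⟩ | ⟨j, hj, ha⟩
      · exact Or.inl ⟨b, Or.inl hb⟩
      by_cases hjk : j = k
      · subst hjk
        by_cases haX : a ∈ Prod.fst '' X
        · obtain ⟨x, hx, rfl⟩ := haX
          exact Or.inl ⟨x.2, Or.inr hx⟩
        · exact Or.inr ⟨n, ⟨hn, hnk⟩, Or.inr ⟨rfl, ha, haX⟩⟩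
      · exact Or.inr ⟨j, ⟨hj, hjk⟩, Or.inl ha⟩
    · rcases hs.cover_right b with ⟨a, ha⟩ | ⟨j, hj, hb⟩
      · exact Or.inl ⟨a, Or.inl ha⟩
      by_cases hjk : j = k
      · subst hjk
        by_cases hbX : b ∈ Prod.snd '' X
        · obtain ⟨x, hx, rfl⟩ := hbX
          exact Or.inl ⟨x.1, Or.inr hx⟩
        · exact Or.inr ⟨n, ⟨hn, hnk⟩, Or.inr ⟨rfl, hb, hbX⟩⟩
      · exact Or.inr ⟨j, ⟨hj, hjk⟩, Or.inl hb⟩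
    · rintro j ⟨hj, hjk⟩ a (ha | ⟨-, ha, haX⟩) b (hab | hab)
      · exact hs.fresh_left j hj a ha b hab
      · exact hout_left j hj hjk a ha b hab
      · exact hs.fresh_left k hk a ha b hab
      · exact haX ⟨_, hab, rfl⟩
    · rintro j ⟨hj, hjk⟩ b (hb | ⟨-, hb, hbX⟩) a (hab | hab)
      · exact hs.fresh_right j hj b hb a hab
      · exact hout_right j hj hjk b hb a hab
      · exact hs.fresh_right k hk b hb a hab
      · exact hbX ⟨_, hab, rfl⟩
    · rintro j ⟨hj, hjk⟩ j' ⟨hj', hjk'⟩ a (ha | ⟨rfl, ha, -⟩) (ha' | ⟨rfl, ha', -⟩)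
      · exact hs.node_left j hj j' hj' a ha ha'
      · exact absurd (hs.node_left j hj k hk a ha ha') hjk
      · exact absurd (hs.node_left j' hj' k hk a ha' ha) hjk'
      · rfl
    · rintro j ⟨hj, hjk⟩ j' ⟨hj', hjk'⟩ b (hb | ⟨rfl, hb, -⟩) (hb' | ⟨rfl, hb', -⟩)
      · exact hs.node_right j hj j' hj' b hb hb'
      · exact absurd (hs.node_right j hj k hk b hb hb') hjk
      · exact absurd (hs.node_right j' hj' k hk b hb' hb) hjk'
      · rfl
  | last k X hk hsel hX =>
    have hX := hX.1
    have hkn : k ∈ s.nodes := hk ▸ rfl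
    -- there are as many unmatched objects on one side as on the other one
    have hA : s.A k = (Prod.fst '' s.M)ᶜ := by
      ext a
      constructor
      · rintro ha ⟨x, hx, rfl⟩
        exact hs.fresh_left k hkn _ ha _ hx
      · intro ha
        rcases hs.cover_left a with ⟨b, hb⟩ | ⟨j, hj, haj⟩
        · exact absurd ⟨_, hb, rfl⟩ ha
        · rw [hk] at hj
          exact (show j = k from hj) ▸ haj
    have hB : s.B k = (Prod.snd '' s.M)ᶜ := by
      ext b
      constructor
      · rintro hb ⟨x, hx, rfl⟩
        exact hs.fresh_right k hkn _ hb _ hx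
      · intro hb
        rcases hs.cover_right b with ⟨a, ha⟩ | ⟨j, hj, hbj⟩
        · exact absurd ⟨_, ha, rfl⟩ hb
        · rw [hk] at hj
          exact (show j = k from hj) ▸ hbj
    have hcard : (s.A k).ncard = (s.B k).ncard := by
      rw [hA, hB, Set.ncard_compl, Set.ncard_compl,
        Set.InjOn.ncard_image fun x hx y hy hxy =>
          Prod.ext hxy (hs.left_unique x.1 x.2 y.2 hx (by rw [hxy]; exact hy)),
        Set.InjOn.ncard_image fun x hx y hy hxy =>
          Prod.ext (hs.right_unique x.1 y.1 x.2 hx (by rw [hxy]; exact hy)) hxy,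
        Nat.card_sum, Nat.card_sum, add_comm]
    obtain ⟨hXA, hXB⟩ := hX.exhausted_both hcard
    refine ⟨fun a => Or.inl ?_, fun b => Or.inl ?_, fun _ hj => hj.elim, fun _ hj => hj.elim,
      fun _ hj => hj.elim, fun _ hj => hj.elim, hs.union_left_unique hkn hX,
      hs.union_right_unique hkn hX⟩
    · by_cases ha : a ∈ s.A k
      · rw [hXA] at ha
        obtain ⟨x, hx, rfl⟩ := ha
        exact ⟨x.2, Or.inr hx⟩
      · rw [hA, Set.notMem_compl_iff] at ha
        obtain ⟨x, hx, rfl⟩ := ha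
        exact ⟨x.2, Or.inl hx⟩
    · by_cases hb : b ∈ s.B k
      · rw [hXB] at hb
        obtain ⟨x, hx, rfl⟩ := hb
        exact ⟨x.1, Or.inr hx⟩
      · rw [hB, Set.notMem_compl_iff] at hb
        obtain ⟨x, hx, rfl⟩ := hb
        exact ⟨x.1, Or.inl hx⟩

theorem consistent_of_run {s : AssignState V W L}
    (hs : Relation.ReflTransGen (AssignStep G lG H h) (initialState G lG H lH h) s) :
    s.Consistent := by
  induction hs with
  | refl => exact consistent_initialState
  | tail _ hst ih => exact ih.step hst

end Output

/-! ### Edit paths without cost -/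

section Cost

variable {V W L : Type*} {G : SimpleGraph V} {lG : V → L} {H : SimpleGraph W} {lH : W → L}
  {M : Set ((V ⊕ W) × (W ⊕ V))}

theorem EditCosts.cost_nonneg (C : EditCosts L) (lG : V → L) (lH : W → L) (o : EditOp V W) :
    0 ≤ C.cost lG lH o := by
  cases o with
  | delVertex v => exact (C.delVertex_pos _).le
  | insVertex w => exact (C.insVertex_pos _).le
  | subVertex v w =>
    by_cases hvw : lG v = lH w
    · rw [EditCosts.cost, hvw, C.subVertex_self]
    · exact (C.subVertex_pos _ _ hvw).le
  | delEdge e => exact C.delEdge_pos.le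
  | insEdge f => exact C.insEdge_pos.le
  | subEdge e f => exact le_rfl

theorem editPathCost_eq_zero_iff [Finite V] [Finite W] (C : EditCosts L) :
    editPathCost C G lG H lH M = 0 ↔ ∀ o ∈ inducedEditPath G H M, C.cost lG lH o = 0 := by
  have := finite_editOp V W
  rw [editPathCost, finsum_mem_eq_finite_toFinset_sum _ (Set.toFinite _),
    Finset.sum_eq_zero_iff_of_nonneg fun o _ => C.cost_nonneg lG lH o]
  simp

/-- If the edit path of a one-to-one assignment costs nothing, then the assignment is an
isomorphism. -/
theorem colouredIso_of_editPathCost_eq_zero [Finite V] [Finite W] {C : EditCosts L}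
    (hleft : ∀ a, ∃ b, (a, b) ∈ M) (hright : ∀ b, ∃ a, (a, b) ∈ M)
    (hlu : ∀ a b b', (a, b) ∈ M → (a, b') ∈ M → b = b')
    (hru : ∀ a a' b, (a, b) ∈ M → (a', b) ∈ M → a = a')
    (h0 : editPathCost C G lG H lH M = 0) : ColouredIso G lG H lH := by
  rw [editPathCost_eq_zero_iff] at h0
  have hV : ∀ v, ∃ w, (Sum.inl v, Sum.inl w) ∈ M := by
    intro v
    obtain ⟨w | z, hw⟩ := hleft (Sum.inl v)
    · exact ⟨w, hw⟩
    · exact absurd (h0 (.delVertex v) ⟨z, hw⟩) (C.delVertex_pos _).ne'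
  have hW : ∀ w, ∃ v, (Sum.inl v, Sum.inl w) ∈ M := by
    intro w
    obtain ⟨v | z, hv⟩ := hright (Sum.inl w)
    · exact ⟨v, hv⟩
    · exact absurd (h0 (.insVertex w) ⟨z, hv⟩) (C.insVertex_pos _).ne'
  choose f hf using hV
  choose g hg using hW
  have hfu : ∀ v w, (Sum.inl v, Sum.inl w) ∈ M → f v = w := fun v w hvw =>
    Sum.inl_injective (hlu _ _ _ (hf v) hvw)
  have hgu : ∀ v w, (Sum.inl v, Sum.inl w) ∈ M → g w = v := fun v w hvw =>
    Sum.inl_injective (hru _ _ _ (hg w) hvw)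
  have hmap : ∀ e e', MapsPair M e e' → Sym2.map f e = e' := by
    rintro _ _ ⟨a, a', b, b', rfl, rfl, hab, hab'⟩
    rw [Sym2.map_mk, hfu _ _ hab, hfu _ _ hab']
  have hmap' : ∀ e e', MapsPair M e e' → Sym2.map g e' = e := by
    rintro _ _ ⟨a, a', b, b', rfl, rfl, hab, hab'⟩
    rw [Sym2.map_mk, hgu _ _ hab, hgu _ _ hab']
  refine ⟨⟨⟨f, g, fun v => hgu _ _ (hf v), fun w => hfu _ _ (hg w)⟩, fun {u v} => ?_⟩, fun v => ?_⟩
  · change H.Adj (f u) (f v) ↔ G.Adj u v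
    constructor
    · intro hadj
      by_contra hn
      refine (C.insEdge_pos.ne' (h0 (.insEdge s(f u, f v)) ⟨hadj, fun e he hm => hn ?_⟩))
      have h1 := hmap' _ _ hm
      rw [Sym2.map_mk, hgu _ _ (hf u), hgu _ _ (hf v)] at h1
      rw [← h1] at he
      exact he
    · intro hadj
      by_contra hn
      refine (C.delEdge_pos.ne' (h0 (.delEdge s(u, v)) ⟨hadj, fun e he hm => hn ?_⟩))
      have h1 := hmap _ _ hm
      rw [Sym2.map_mk] at h1
      rw [← h1] at he
      exact he
  · by_contra hn
    exact (C.subVertex_pos _ _ (Ne.symm hn)).ne' (h0 (.subVertex v (f v)) (hf v))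

/-- If the assignment is an isomorphism on the vertices, then the edit path costs nothing. -/
theorem editPathCost_eq_zero [Finite V] [Finite W] (C : EditCosts L)
    (hleft : ∀ v, ∃ w, (Sum.inl v, Sum.inl w) ∈ M) (hright : ∀ w, ∃ v, (Sum.inl v, Sum.inl w) ∈ M)
    (hlr : ∀ v z, (Sum.inl v, Sum.inr z) ∉ M) (hrl : ∀ z w, (Sum.inr z, Sum.inl w) ∉ M)
    (hlabel : ∀ v w, (Sum.inl v, Sum.inl w) ∈ M → lG v = lH w)
    (hadj : ∀ a b a' b', (Sum.inl a, Sum.inl b) ∈ M → (Sum.inl a', Sum.inl b') ∈ M →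
      (G.Adj a a' ↔ H.Adj b b')) : editPathCost C G lG H lH M = 0 := by
  rw [editPathCost_eq_zero_iff]
  rintro (v | w | ⟨v, w⟩ | e | f | ⟨e, f⟩) ho
  · exact absurd ho.choose_spec (hlr _ _)
  · exact absurd ho.choose_spec (hrl _ _)
  · rw [EditCosts.cost, hlabel v w ho, C.subVertex_self]
  · obtain ⟨he, hf⟩ := ho
    induction e using Sym2.ind with
    | _ a a' =>
      obtain ⟨b, hb⟩ := hleft a
      obtain ⟨b', hb'⟩ := hleft a'
      exact absurd ⟨a, a', b, b', rfl, rfl, hb, hb'⟩ (hf s(b, b') ((hadj _ _ _ _ hb hb').1 he))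
  · obtain ⟨hf, he⟩ := ho
    induction f using Sym2.ind with
    | _ b b' =>
      obtain ⟨a, ha⟩ := hright b
      obtain ⟨a', ha'⟩ := hright b'
      exact absurd ⟨a, a', b, b', rfl, rfl, ha, ha'⟩ (he s(a, a') ((hadj _ _ _ _ ha ha').2 hf))
  · rfl

end Cost

/-! ### Runs on isomorphic graphs -/

section Isomorphic

variable {V W L : Type*} [Fintype V] [Fintype W] {G : SimpleGraph V} {lG : V → L}
  {H : SimpleGraph W} {lH : W → L} {h : ℕ}

/-- What the modified algorithm maintains if the graphs are isomorphic: no object leaves its node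
unmatched, vertices are matched with vertices of the same colour, and the matched pairs form a
partial isomorphism, whose domain consists of the cells of the processed colours. -/
structure AssignState.PartialIso (G : SimpleGraph V) (lG : V → L) (H : SimpleGraph W) (lH : W → L)
    (h : ℕ) (s : AssignState V W L) : Prop where
  left_eq : s.A = (initialState G lG H lH h).A
  right_eq : s.B = (initialState G lG H lH h).B
  rootMap : ∃ r, IsRootMap G lG h {d | WLNode.colour h d ∉ s.nodes} r
  matched : ∀ v, WLNode.colour h (wlColour G lG h v) ∉ s.nodes → ∃ w, (Sum.inl v, Sum.inl w) ∈ s.M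
  processed : ∀ v w, (Sum.inl v, Sum.inl w) ∈ s.M →
    WLNode.colour h (wlColour G lG h v) ∉ s.nodes ∧ wlColour G lG h v = wlColour H lH h w
  inl_inr : ∀ v z, (Sum.inl v, Sum.inr z) ∉ s.M
  inr_inl : ∀ z w, (Sum.inr z, Sum.inl w) ∉ s.M
  adj_iff : ∀ a b a' b', (Sum.inl a, Sum.inl b) ∈ s.M → (Sum.inl a', Sum.inl b') ∈ s.M →
    (G.Adj a a' ↔ H.Adj b b')

theorem partialIso_initialState : (initialState G lG H lH h).PartialIso G lG H lH h where
  left_eq := rfl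
  right_eq := rfl
  rootMap := ⟨id, isRootMap_of_forall_notMem fun v hv =>
    hv (Or.inr (Or.inr (Or.inl ⟨h, le_rfl, v, rfl⟩)))⟩
  matched v hv := absurd (Or.inr (Or.inr (Or.inl ⟨h, le_rfl, v, rfl⟩))) hv
  processed _ _ hvw := hvw.elim
  inl_inr _ _ hvz := hvz
  inr_inl _ _ hzw := hzw
  adj_iff _ _ _ _ hab := hab.elim

/-- Isomorphic graphs have the same numbers of objects at each node. -/
theorem ncard_initialState_eq (ψ : G ≃g H) (hψ : ∀ v, lH (ψ v) = lG v) (k : WLNode L) :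
    ((initialState G lG H lH h).A k).ncard = ((initialState G lG H lH h).B k).ncard := by
  refine Nat.card_congr ((Equiv.sumCongr ψ.toEquiv ψ.toEquiv.symm).subtypeEquiv fun a => ?_)
  rcases a with v | w
  · change WLNode.colour h _ = k ↔ WLNode.colour h _ = k
    rw [← wlColour_iso ψ hψ h v]
    rfl
  · exact Iff.rfl

/-- There is a pairing of the two cells of a colour that respects the edges, since the partial
isomorphism extends to the cell. -/
theorem AssignState.PartialIso.exists_respectsEdges {s : AssignState V W L}
    (hs : s.PartialIso G lG H lH h) (hc : s.Consistent)
    (hU : UniqueRealization G (wlColour G lG h)) (ψ : G ≃g H) (hψ : ∀ v, lH (ψ v) = lG v)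
    {c : WLColour L h} (hk : WLNode.colour h c ∈ s.nodes)
    (hmay : MayProcess G lG h {d | WLNode.colour h d ∉ s.nodes} c) :
    ∃ Y, IsPairing (s.A (.colour h c)) (s.B (.colour h c)) Y ∧ RespectsEdges G H s.M Y := by
  classical
  obtain ⟨r, hr⟩ := hs.rootMap
  let m : V → W := fun v =>
    if hv : WLNode.colour h (wlColour G lG h v) ∉ s.nodes then (hs.matched v hv).choose else ψ v
  have hm : ∀ v, WLNode.colour h (wlColour G lG h v) ∉ s.nodes →
      (Sum.inl v, Sum.inl (m v)) ∈ s.M := fun v hv => by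
    simp only [m, dif_pos hv]
    exact (hs.matched v hv).choose_spec
  have hψc : ∀ v, wlColour H lH h (ψ v) = wlColour G lG h v := wlColour_iso ψ hψ h
  obtain ⟨σ, hσ, hσP⟩ := hr.exists_extension hU (fun hcon => hcon hk) hmay
    (g := fun v => ψ.symm (m v)) (fun u hu => by
      rw [(hs.processed u _ (hm u hu)).2, ← hψc, RelIso.apply_symm_apply])
    (fun u v hu hv huv => by
      have h1 := hm v hv
      rw [← ψ.symm.injective huv] at h1
      exact Sum.inl_injective (hc.right_unique _ _ _ (hm u hu) h1))
  let τ : {v // wlColour G lG h v = c} → W := fun y => ψ (σ y)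
  have hτ : Function.Injective τ := fun y y' hy =>
    σ.injective (Subtype.ext (ψ.injective hy))
  rw [hs.left_eq, hs.right_eq]
  refine ⟨Set.range fun y : {v // wlColour G lG h v = c} => (Sum.inl y.1, Sum.inl (τ y)),
    ⟨?_, ?_, ?_, Or.inl ?_⟩, ?_⟩
  · rintro _ ⟨y, rfl⟩
    constructor
    · change WLNode.colour h _ = WLNode.colour h _
      rw [y.2]
    · change WLNode.colour h _ = WLNode.colour h _
      rw [hψc, (σ y).2]
  · rintro a b b' ⟨y, hy⟩ ⟨y', hy'⟩
    simp only [Prod.mk.injEq] at hy hy'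
    have : y = y' := Subtype.ext (Sum.inl_injective (hy.1.trans hy'.1.symm))
    rw [← hy.2, ← hy'.2, this]
  · rintro a a' b ⟨y, hy⟩ ⟨y', hy'⟩
    simp only [Prod.mk.injEq] at hy hy'
    have : y = y' := hτ (Sum.inl_injective (hy.2.trans hy'.2.symm))
    rw [← hy.1, ← hy'.1, this]
  · rintro (v | w) ha
    · have hv : wlColour G lG h v = c := by
        change WLNode.colour h _ = WLNode.colour h c at ha
        simpa using ha
      exact ⟨_, ⟨⟨v, hv⟩, rfl⟩, rfl⟩
    · change WLNode.indel = WLNode.colour h c at ha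
      simp at ha
  · rintro a b a' b' ⟨y, hy⟩ hab'
    simp only [Prod.mk.injEq, Sum.inl.injEq] at hy
    obtain ⟨rfl, rfl⟩ := hy
    rcases hab' with ⟨y', hy'⟩ | hab'
    · simp only [Prod.mk.injEq, Sum.inl.injEq] at hy'
      obtain ⟨rfl, rfl⟩ := hy'
      rw [← hσ]
      exact ψ.map_adj_iff.symm
    · have hP := (hs.processed _ _ hab').1
      have hb : m a' = b' := Sum.inl_injective (hc.left_unique _ _ _ (hm a' hP) hab')
      rw [← hσP y a' hP, ← ψ.map_adj_iff, RelIso.apply_symm_apply, hb]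

/-- Selecting the node `k` maintains the partial isomorphism, whether `k` is a leaf or the last
node: both sides hold equally many objects at `k`, so that none is passed on. -/
theorem AssignState.PartialIso.step_aux {s : AssignState V W L} (hs : s.PartialIso G lG H lH h)
    (hc : s.Consistent) (hU : UniqueRealization G (wlColour G lG h)) (ψ : G ≃g H)
    (hψ : ∀ v, lH (ψ v) = lG v) {k : WLNode L} (hk : k ∈ s.nodes)
    (hsel : MaySelect G lG h s.nodes k) {X : Set ((V ⊕ W) × (W ⊕ V))}
    (hX : IsModifiedPairing G H s.M (s.A k) (s.B k) X) {t : AssignState V W L}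
    (htn : t.nodes = s.nodes \ {k}) (htM : t.M = s.M ∪ X) (htA : t.A = s.A) (htB : t.B = s.B) :
    t.PartialIso G lG H lH h := by
  have hXA : ∀ a b, (a, b) ∈ X → objectNode G lG h a = k ∧ objectNode H lH h b = k := by
    intro a b hab
    have h1 := hX.1.subset hab
    rw [hs.left_eq, hs.right_eq] at h1
    exact h1
  have hex := hX.1.exhausted_both (by
    rw [hs.left_eq, hs.right_eq]; exact ncard_initialState_eq ψ hψ k)
  have hmem : ∀ d, WLNode.colour h d ∉ t.nodes ↔ WLNode.colour h d = k ∨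
      WLNode.colour h d ∉ s.nodes := by
    intro d
    rw [htn, Set.mem_sdiff, Set.mem_singleton_iff]
    tauto
  have hrespect : RespectsEdges G H s.M X := by
    by_cases hkc : ∃ c, k = .colour h c
    · obtain ⟨c, rfl⟩ := hkc
      exact hX.2 (hs.exists_respectsEdges hc hU ψ hψ hk (hsel c rfl))
    · intro a b a' b' hab
      exact absurd ⟨_, (hXA _ _ hab).1.symm⟩ hkc
  refine ⟨htA.trans hs.left_eq, htB.trans hs.right_eq, ?_, fun v hv => ?_, fun v w hvw => ?_,
    fun v z hvz => ?_, fun z w hzw => ?_, fun a b a' b' hab hab' => ?_⟩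
  · obtain ⟨r, hr⟩ := hs.rootMap
    by_cases hkc : ∃ c, k = .colour h c
    · obtain ⟨c, rfl⟩ := hkc
      have hset : {d | WLNode.colour h d ∉ t.nodes} =
          insert c {d | WLNode.colour h d ∉ s.nodes} := by
        ext d
        simp [hmem]
      rw [hset]
      exact hr.insert hU (fun hcon => hcon hk) (hsel c rfl)
    · have hset : {d | WLNode.colour h d ∉ t.nodes} = {d | WLNode.colour h d ∉ s.nodes} := by
        ext d
        simp only [Set.mem_ofPred_eq, hmem]
        exact ⟨fun h1 => h1.resolve_left fun e => hkc ⟨d, e.symm⟩, Or.inr⟩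
      rw [hset]
      exact ⟨r, hr⟩
  · rw [htM]
    rcases (hmem _).1 hv with h1 | h1
    · have hvA : Sum.inl v ∈ s.A k := by rw [hs.left_eq]; exact h1
      rw [hex.1] at hvA
      obtain ⟨⟨_, b⟩, hb, rfl⟩ := hvA
      rcases b with w | z
      · exact ⟨w, Or.inr hb⟩
      · have h2 := hXA _ _ hb
        have h3 := h2.1.trans h2.2.symm
        simp [objectNode] at h3
    · obtain ⟨w, hw⟩ := hs.matched v h1
      exact ⟨w, Or.inl hw⟩
  · rw [htM] at hvw
    rcases hvw with hvw | hvw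
    · obtain ⟨h1, h2⟩ := hs.processed v w hvw
      exact ⟨(hmem _).2 (Or.inr h1), h2⟩
    · have h2 := hXA _ _ hvw
      have h3 := h2.1.trans h2.2.symm
      exact ⟨(hmem _).2 (Or.inl h2.1), by simpa [objectNode] using h3⟩
  · rw [htM] at hvz
    rcases hvz with hvz | hvz
    · exact hs.inl_inr v z hvz
    · have h2 := hXA _ _ hvz
      have h3 := h2.1.trans h2.2.symm
      simp [objectNode] at h3
  · rw [htM] at hzw
    rcases hzw with hzw | hzw
    · exact hs.inr_inl z w hzw
    · have h2 := hXA _ _ hzw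
      have h3 := h2.1.trans h2.2.symm
      simp [objectNode] at h3
  · rw [htM] at hab hab'
    rcases hab with hab | hab
    · rcases hab' with hab' | hab'
      · exact hs.adj_iff a b a' b' hab hab'
      · rw [G.adj_comm, H.adj_comm]
        exact hrespect a' b' a b hab' (Or.inr hab)
    · exact hrespect a b a' b' hab hab'.symm

theorem AssignState.PartialIso.step {s t : AssignState V W L} (hs : s.PartialIso G lG H lH h)
    (hc : s.Consistent) (hU : UniqueRealization G (wlColour G lG h)) (ψ : G ≃g H)
    (hψ : ∀ v, lH (ψ v) = lG v) (hst : AssignStep G lG H h s t) : t.PartialIso G lG H lH h := by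
  cases hst with
  | leaf k n X hk hn hadj huniq hsel hX =>
    have hex := hX.1.exhausted_both (by
      rw [hs.left_eq, hs.right_eq]; exact ncard_initialState_eq ψ hψ k)
    refine hs.step_aux hc hU ψ hψ hk hsel hX rfl rfl (funext fun j => ?_) (funext fun j => ?_)
    · ext a
      refine ⟨fun ha => ha.resolve_right fun h1 => h1.2.2 ?_, Or.inl⟩
      rw [← hex.1]
      exact h1.2.1
    · ext b
      refine ⟨fun hb => hb.resolve_right fun h1 => h1.2.2 ?_, Or.inl⟩
      rw [← hex.2]
      exact h1.2.1
  | last k X hk hsel hX =>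
    exact hs.step_aux hc hU ψ hψ (hk ▸ rfl) hsel hX (by simp [hk]) rfl rfl rfl

theorem partialIso_of_run (hU : UniqueRealization G (wlColour G lG h)) (ψ : G ≃g H)
    (hψ : ∀ v, lH (ψ v) = lG v) {s : AssignState V W L}
    (hs : Relation.ReflTransGen (AssignStep G lG H h) (initialState G lG H lH h) s) :
    s.PartialIso G lG H lH h := by
  induction hs with
  | refl => exact partialIso_initialState
  | tail hs hst ih => exact ih.step (consistent_of_run hs) hU ψ hψ hst

end Isomorphic

theorem mainTheorem4 {V W L : Type*} [Fintype V] [Fintype W]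
    (G : SimpleGraph V) (lG : V → L) (H : SimpleGraph W) (lH : W → L)
    (hG : Amenable G lG) (hH : Amenable H lH)
    (h : ℕ) (hGh : StableAt G lG h) (hHh : StableAt H lH h)
    (C : EditCosts L) :
    (∃ x, IsApproxGED C G lG H lH h x) ∧
      ∀ x, IsApproxGED C G lG H lH h x → (x = 0 ↔ ColouredIso G lG H lH) := by
  refine ⟨?_, ?_⟩
  · obtain ⟨M, hM⟩ := exists_isAlgorithmOutput G lG H lH h
    exact ⟨_, M, hM, rfl⟩
  · rintro _ ⟨_, ⟨s, hs, hs0, rfl⟩, rfl⟩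
    have hc := consistent_of_run hs
    have hleft : ∀ a, ∃ b, (a, b) ∈ s.M := fun a =>
      (hc.cover_left a).resolve_right fun ⟨k, hk, _⟩ => by rw [hs0] at hk; exact hk
    have hright : ∀ b, ∃ a, (a, b) ∈ s.M := fun b =>
      (hc.cover_right b).resolve_right fun ⟨k, hk, _⟩ => by rw [hs0] at hk; exact hk
    constructor
    · exact colouredIso_of_editPathCost_eq_zero hleft hright hc.left_unique hc.right_unique
    · rintro ⟨ψ, hψ⟩
      have hp := partialIso_of_run (hG.uniqueRealization hGh) ψ hψ hs
      refine editPathCost_eq_zero C (fun v => hp.matched v (by simp [hs0])) (fun w => ?_) hp.inl_inr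
        hp.inr_inl (fun v w hvw => label_eq_of_wlColour_eq (hp.processed v w hvw).2) hp.adj_iff
      obtain ⟨v | z, hv⟩ := hright (Sum.inl w)
      · exact ⟨v, hv⟩
      · exact absurd hv (hp.inr_inl z w)
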